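/- **Setting.** Let $d\ge 1$, $L>0$, $N\ge 2$ an even integer, $\mathbf j_*\in\mathbb Z^d\setminus\{\mathbf 0\}$ and $\phi>0$ (the Fourier component $\phi_{\mathbf j_*}=\phi_{-\mathbf j_*}$ of the pair potential). For $\mathbf j\in\mathbb Z^d$ put $k_{\mathbf j}=\frac{2\pi}{L}\mathbf j$, and let $a_{\mathbf j},a^*_{\mathbf j}$ be the bosonic annihilation and creation operators of the modes $\mathbf j$. On the $N$-particle Fock space $\mathcal F^N$ over $L^2$ of the periodic box of side $L$ let $$W=\phi\,\frac{a^*_{\mathbf 0}a^*_{\mathbf 0}a_{\mathbf j_*}a_{-\mathbf j_*}}{N},\qquad W^*=\phi\,\frac{a_{\mathbf 0}a_{\mathbf 0}a^*_{\mathbf j_*}a^*_{-\mathbf j_*}}{N},$$ $$H=\sum_{\mathbf j\ne\pm\mathbf j_*}k_{\mathbf j}^2\,a^*_{\mathbf j}a_{\mathbf j}+\Big(k_{\mathbf j_*}^2+\phi\,\frac{a^*_{\mathbf 0}a_{\mathbf 0}}{N}\Big)\big(a^*_{\mathbf j_*}a_{\mathbf j_*}+a^*_{-\mathbf j_*}a_{-\mathbf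 j_*}\big)+W+W^* .$$ Let $\eta=\frac1{\sqrt{N!}}(a^*_{\mathbf 0})^N\Omega$, $\epsilon=k_{\mathbf j_*}^2/\phi$ and $E^{Bog}=-\big[k_{\mathbf j_*}^2+\phi-\sqrt{(k_{\mathbf j_*}^2)^2+2\phi k_{\mathbf j_*}^2}\,\big]$. For even $0\le i\le N-2$ let $Q^{(i,i+1)}$ be the orthogonal projection onto the states with $N-i$ or $N-i-1$ particles in the modes $\pm\mathbf j_*$, and for $z\in\mathbb R$ let $$R_{i}(z)=Q^{(i,i+1)}\frac{1}{Q^{(i,i+1)}(H-z)Q^{(i,i+1)}}Q^{(i,i+1)}$$ (inverse on the range of $Q^{(i,i+1)}$). Put $\Gamma_0(z)=0$ and, for even $2\le i\le N-2$, $$\Gamma_i(z)=Q^{(i,i+1)}WQ^{(i-2,i-1)}\,R_{i-2}(z)\sum_{l=0}^\infty\big[\Gamma_{i-2}(z)R_{i-2}(z)\big]^l\,Q^{(i-2,i-1)}W^*Q^{(i,i+1)},$$ and define $$f(z)=-z-\Big\langle\eta,\;W\,R_{N-2}(z)\sum_{l=0}^\infty\big[\Gamma_{N-2}(z)R_{N-2}(z)\big]^l\,W^*\eta\Big\rangle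 .$$ We say that $f(z)$ is well defined if, for every even $0\le i\le N-2$, $Q^{(i,i+1)}(H-z)Q^{(i,i+1)}$ is boundedly invertible on the range of $Q^{(i,i+1)}$ and the series $\sum_l[\Gamma_i(z)R_i(z)]^l$ converges in operator norm. **Theorem.** For every $0<\gamma<1$ there are constants $k_\gamma>0$ and $\epsilon_0>0$, depending only on $\gamma$, such that the following holds for all $d,L,N,\mathbf j_*,\phi$ as above with $\epsilon\le\epsilon_0$ and $$\epsilon^2+\frac{\epsilon}{N^{\gamma}}+\frac1N\le k_\gamma\,\epsilon\sqrt\epsilon,\qquad \frac{1}{N^{1-\gamma}}\le k_\gamma\,\epsilon .$$ Put $z_{\max}=E^{Bog}+\sqrt\epsilon\,\phi\sqrt{\epsilon^2+2\epsilon}$. Then $z_{\max}<0$; $f(z)$ is well defined for every real $z\le z_{\max}$; there is exactly one point $z_*\le z_{\max}$ with $f(z_*)=0$; and $$z_*<E^{Bog}+\frac{2\sqrt2+3}{6}\,\sqrt\epsilon\,\phi\,\sqrt{\epsilon^2+2\epsilon}.$$ -/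

import Mathlib

namespace ThreeModeBog

noncomputable section

/-- Modes of the periodic box: `j` labels the plane wave of momentum `k_j = (2π/L) j`. -/
abbrev Mode (d : ℕ) : Type := Fin d → ℤ

/-- Occupation numbers of `N` bosons: finitely supported `n` with `∑ j, n j = N`. -/
abbrev Occ (d N : ℕ) : Type := {n : Mode d →₀ ℕ // n.degree = N}

/-- The `N`-particle subspace of the bosonic Fock space over `L²` of the box, in the occupation
number representation: `ψ n` is the coefficient of `ψ` along the normalized product state
`∏ j, (a*_j)^(n j) / √(n j)! Ω` (these states form an orthonormal basis). -/
abbrev FockN (d N : ℕ) : Type := lp (fun _ : Occ d N => ℂ) 2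

section WeightedShift

variable {A B : Type*}

/-- Coefficients of a weighted shift: `a ↦ w a * ψ (g a)`, and `0` where `g a` is undefined. -/
def shiftFun (g : A → Option B) (w : A → ℂ) (ψ : B → ℂ) (a : A) : ℂ :=
  (g a).elim 0 (fun b => w a * ψ b)

theorem shiftFun_sum_le (g : A → Option B)
    (hg : ∀ a a' b, g a = some b → g a' = some b → a = a') (w : A → ℂ) (C : ℝ)
    (hw : ∀ a, ‖w a‖ ≤ C) (hC : 0 ≤ C) (ψ : lp (fun _ : B => ℂ) 2) (s : Finset A) :
    ∑ a ∈ s, ‖shiftFun g w ψ a‖ ^ (2 : ENNReal).toReal ≤ (C * ‖ψ‖) ^ (2 : ENNReal).toReal := by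
  classical
  have h2 : 0 < (2 : ENNReal).toReal := by norm_num
  have key : ∑ a ∈ s, ‖shiftFun g w ψ a‖ ^ (2 : ENNReal).toReal
      ≤ ∑ b ∈ s.filterMap g (fun a a' b h h' => hg a a' b h h'),
        C ^ (2 : ENNReal).toReal * ‖ψ b‖ ^ (2 : ENNReal).toReal := by
    induction s using Finset.induction_on with
    | empty => simp
    | insert a s ha ih =>
      rw [Finset.sum_insert ha]
      cases hga : g a with
      | none =>
        have h0 : shiftFun g w ψ a = 0 := by simp [shiftFun, hga]
        rw [h0, norm_zero, Real.zero_rpow h2.ne', zero_add]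
        refine ih.trans (le_of_eq ?_)
        congr 1
        ext b
        simp only [Finset.mem_filterMap, Finset.mem_insert]
        constructor
        · rintro ⟨x, hx, hxb⟩
          exact ⟨x, Or.inr hx, hxb⟩
        · rintro ⟨x, rfl | hx, hxb⟩
          · simp [hga] at hxb
          · exact ⟨x, hx, hxb⟩
      | some b =>
        have h1 : (insert a s).filterMap g (fun a a' b h h' => hg a a' b h h')
            = insert b (s.filterMap g (fun a a' b h h' => hg a a' b h h')) := by
          ext c
          simp only [Finset.mem_filterMap, Finset.mem_insert]
          constructor
          · rintro ⟨x, rfl | hx, hxc⟩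
            · left
              rw [hga] at hxc
              exact (Option.some.inj hxc).symm
            · exact Or.inr ⟨x, hx, hxc⟩
          · rintro (rfl | ⟨x, hx, hxc⟩)
            · exact ⟨a, Or.inl rfl, hga⟩
            · exact ⟨x, Or.inr hx, hxc⟩
        have h3 : b ∉ s.filterMap g (fun a a' b h h' => hg a a' b h h') := by
          simp only [Finset.mem_filterMap]
          rintro ⟨x, hx, hxb⟩
          exact ha (hg a x b hga hxb ▸ hx)
        rw [h1, Finset.sum_insert h3]
        refine add_le_add ?_ ih
        have h4 : shiftFun g w ψ a = w a * ψ b := by simp [shiftFun, hga]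
        rw [h4, norm_mul, Real.mul_rpow (norm_nonneg _) (norm_nonneg _)]
        gcongr
        exact hw a
  refine key.trans ?_
  rw [← Finset.mul_sum, Real.mul_rpow hC (norm_nonneg _)]
  gcongr
  exact lp.sum_rpow_le_norm_rpow h2 ψ _

/-- The bounded operator `ψ ↦ (a ↦ w a * ψ (g a))` between `ℓ²` spaces, for a bounded weight `w`
and a partially defined injective map `g`. -/
def shiftCLM (g : A → Option B) (hg : ∀ a a' b, g a = some b → g a' = some b → a = a')
    (w : A → ℂ) (C : ℝ) (hw : ∀ a, ‖w a‖ ≤ C) (hC : 0 ≤ C) :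
    lp (fun _ : B => ℂ) 2 →L[ℂ] lp (fun _ : A => ℂ) 2 :=
  LinearMap.mkContinuous
    { toFun := fun ψ => ⟨shiftFun g w ψ, memℓp_gen' (shiftFun_sum_le g hg w C hw hC ψ)⟩
      map_add' := by
        intro x y
        ext a
        change shiftFun g w _ a = shiftFun g w x a + shiftFun g w y a
        cases hga : g a <;> simp [shiftFun, hga, mul_add]
      map_smul' := by
        intro c x
        ext a
        cases hga : g a <;> simp [shiftFun, hga, mul_left_comm] }
    C
    (by
      intro ψ
      refine lp.norm_le_of_forall_sum_le (by norm_num) (by positivity) ?_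
      intro s
      exact shiftFun_sum_le g hg w C hw hC ψ s)

end WeightedShift

/-- `n ↦ n + δ_j`, from `N - 1` to `N` particles (undefined if `N = 0`). -/
def addOne (d N : ℕ) (j : Mode d) (n : Occ d (N - 1)) : Option (Occ d N) :=
  if h : (n.1 + Finsupp.single j 1).degree = N then some ⟨n.1 + Finsupp.single j 1, h⟩ else none

theorem addOne_inj (d N : ℕ) (j : Mode d) (n n' : Occ d (N - 1)) (m : Occ d N)
    (h : addOne d N j n = some m) (h' : addOne d N j n' = some m) : n = n' := by
  unfold addOne at h h'
  split_ifs at h h'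
  have e := Option.some.inj (h.trans h'.symm)
  exact Subtype.ext (add_right_cancel (congrArg Subtype.val e))

theorem sqrt_occ_le (d N : ℕ) (j : Mode d) (n : Occ d (N - 1)) :
    ‖((Real.sqrt ((n.1 j : ℝ) + 1) : ℝ) : ℂ)‖ ≤ Real.sqrt ((N : ℝ) + 1) := by
  rw [Complex.norm_real, Real.norm_of_nonneg (Real.sqrt_nonneg _)]
  apply Real.sqrt_le_sqrt
  have h1 : n.1 j ≤ n.1.degree := Finsupp.le_degree j n.1
  have h2 : n.1 j ≤ N := by
    have := n.2
    omega
  have h3 : (n.1 j : ℝ) ≤ N := by exact_mod_cast h2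
  linarith

/-- The annihilation operator `a_j`, from `N` to `N - 1` particles:
`(a_j ψ)(n) = √(n_j + 1) ψ(n + δ_j)`; it is `0` on the vacuum sector `N = 0`. -/
def annih (d N : ℕ) (j : Mode d) : FockN d N →L[ℂ] FockN d (N - 1) :=
  shiftCLM (addOne d N j) (addOne_inj d N j) (fun n => ((Real.sqrt ((n.1 j : ℝ) + 1) : ℝ) : ℂ))
    (Real.sqrt ((N : ℝ) + 1)) (sqrt_occ_le d N j) (Real.sqrt_nonneg _)

/-- The creation operator `a*_j`, from `N - 1` to `N` particles. -/
def create (d N : ℕ) (j : Mode d) : FockN d (N - 1) →L[ℂ] FockN d N :=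
  ContinuousLinearMap.adjoint (annih d N j)

/-- The number operator `a*_j a_j` on the `N`-particle space. -/
def num (d N : ℕ) (j : Mode d) : FockN d N →L[ℂ] FockN d N :=
  create d N j ∘L annih d N j

/-- The kinetic energy `k_j² = |2π j / L|²` of the mode `j` (with `m = 1/2`). -/
def kSq {d : ℕ} (L : ℝ) (j : Mode d) : ℝ := ∑ i, (2 * Real.pi / L * (j i : ℝ)) ^ 2

/-- `W = φ a*_0 a*_0 a_{j*} a_{-j*} / N`. -/
def W (d N : ℕ) (φ : ℝ) (js : Mode d) : FockN d N →L[ℂ] FockN d N :=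
  ((φ / N : ℝ) : ℂ) • (create d N 0 ∘L create d (N - 1) 0 ∘L annih d (N - 1) js ∘L annih d N (-js))

/-- `W* = φ a_0 a_0 a*_{j*} a*_{-j*} / N`. -/
def Wstar (d N : ℕ) (φ : ℝ) (js : Mode d) : FockN d N →L[ℂ] FockN d N :=
  ContinuousLinearMap.adjoint (W d N φ js)

/-- `Ĥ⁰ = (k² + φ a*_0 a_0 / N) a*_{j*} a_{j*} + (k² + φ a*_0 a_0 / N) a*_{-j*} a_{-j*}`
with `k² = k_{j*}²`. -/
def hHat0 (d N : ℕ) (L φ : ℝ) (js : Mode d) : FockN d N →L[ℂ] FockN d N :=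
  (((kSq L js : ℝ) : ℂ) • 1 + ((φ / N : ℝ) : ℂ) • num d N 0) * num d N js +
    (((kSq L js : ℝ) : ℂ) • 1 + ((φ / N : ℝ) : ℂ) • num d N 0) * num d N (-js)

/-- The value of `∑_{j ≠ ±j*} k_j² a*_j a_j` on the product state with occupation numbers `n`. -/
def kinOther {d N : ℕ} (L : ℝ) (js : Mode d) (n : Occ d N) : ℝ :=
  n.1.sum (fun j m => if j = js ∨ j = -js then 0 else kSq L j * m)

/-- The (unbounded, self-adjoint) operator `∑_{j ≠ ±j*} k_j² a*_j a_j` on its natural domain. -/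
def kinetic (d N : ℕ) (L : ℝ) (js : Mode d) : FockN d N →ₗ.[ℂ] FockN d N where
  domain :=
    { carrier := {ψ | Memℓp (fun n : Occ d N => (kinOther L js n : ℂ) * ψ n) 2}
      zero_mem' := by
        have h : (fun n : Occ d N => (kinOther L js n : ℂ) * (0 : FockN d N) n) = 0 := by
          ext n
          simp
        change Memℓp _ 2
        rw [h]
        exact zero_memℓp
      add_mem' := by
        intro a b ha hb
        have h := Memℓp.add ha hb
        refine (congrArg (fun f => Memℓp f 2) ?_).mp h
        ext n
        simp [mul_add]
      smul_mem' := by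
        intro c a ha
        have h := Memℓp.const_smul ha c
        refine (congrArg (fun f => Memℓp f 2) ?_).mp h
        ext n
        simp [mul_left_comm] }
  toFun :=
    { toFun := fun ψ => ⟨fun n => (kinOther L js n : ℂ) * ψ.1 n, ψ.2⟩
      map_add' := by
        intro x y
        ext n
        exact mul_add _ _ _
      map_smul' := by
        intro c x
        ext n
        simp [mul_left_comm] }

/-- The three-modes Bogoliubov Hamiltonian
`H = ∑_{j ≠ ±j*} k_j² a*_j a_j + Ĥ⁰ + W + W*` on the `N`-particle space. -/
def hBog (d N : ℕ) (L φ : ℝ) (js : Mode d) : FockN d N →ₗ.[ℂ] FockN d N where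
  domain := (kinetic d N L js).domain
  toFun := (kinetic d N L js).toFun +
    ((hHat0 d N L φ js + W d N φ js + Wstar d N φ js : FockN d N →L[ℂ] FockN d N) :
      FockN d N →ₗ[ℂ] FockN d N).domRestrict (kinetic d N L js).domain

open Classical in
/-- `Q^{(i,i+1)}`: the orthogonal projection onto the states with `N - i` or `N - i - 1`
particles in the modes `±j*`. -/
def Q (d N : ℕ) (js : Mode d) (i : ℕ) : FockN d N →L[ℂ] FockN d N :=
  shiftCLM some (fun _ _ _ h h' => Option.some.inj (h.trans h'.symm))
    (fun n => if n.1 js + n.1 (-js) + i = N ∨ n.1 js + n.1 (-js) + i + 1 = N then 1 else 0) 1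
    (by
      intro n
      split_ifs <;> simp)
    zero_le_one

/-- `R = Q (Q (H - z) Q)⁻¹ Q`: the bounded operator that vanishes on `(Q E)ᗮ` and on `Q E` is the
inverse of the (possibly unbounded) operator `Q (H - z) Q`. Such an `R` is unique. -/
structure IsReducedResolvent {E : Type*} [NormedAddCommGroup E] [NormedSpace ℂ E]
    (H : E →ₗ.[ℂ] E) (Q : E →L[ℂ] E) (z : ℂ) (R : E →L[ℂ] E) : Prop where
  left_proj : Q * R = R
  right_proj : R * Q = R
  mem_domain : ∀ ψ, R ψ ∈ H.domain
  right_inv : ∀ ψ, Q (H ⟨R ψ, mem_domain ψ⟩ - z • R ψ) = Q ψ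
  left_inv : ∀ ψ : H.domain, Q ψ = ψ → R (Q (H ψ - z • (ψ : E))) = ψ

open Classical in
/-- The operator `R` above if it exists (and `0` otherwise). -/
def reducedResolvent {E : Type*} [NormedAddCommGroup E] [NormedSpace ℂ E]
    (H : E →ₗ.[ℂ] E) (Q : E →L[ℂ] E) (z : ℂ) : E →L[ℂ] E :=
  if h : ∃ R, IsReducedResolvent H Q z R then h.choose else 0

/-- `R_{i,i}(z) = Q^{(i,i+1)} (Q^{(i,i+1)} (H - z) Q^{(i,i+1)})⁻¹ Q^{(i,i+1)}`. -/
def resBog (d N : ℕ) (L φ : ℝ) (js : Mode d) (z : ℝ) (i : ℕ) : FockN d N →L[ℂ] FockN d N :=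
  reducedResolvent (hBog d N L φ js) (Q d N js i) (z : ℂ)

/-- `gammaBog … k` is `Γ_{i,i}(z)` with `i = 2 k`:
`Γ_{i+2,i+2} = W_{i+2,i} R_{i,i} (∑_l [Γ_{i,i} R_{i,i}]^l) W*_{i,i+2}`, where
`W_{i,i'} = Q^{(i,i+1)} W Q^{(i',i'+1)}` and `W*_{i,i'} = Q^{(i,i+1)} W* Q^{(i',i'+1)}`.
The start `Γ_{0,0} = 0` gives `Γ_{2,2} = W_{2,0} R_{0,0} W*_{0,2}`. The series is taken in
operator norm. -/
def gammaBog (d N : ℕ) (L φ : ℝ) (js : Mode d) (z : ℝ) : ℕ → (FockN d N →L[ℂ] FockN d N)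
  | 0 => 0
  | k + 1 =>
    (Q d N js (2 * k + 2) * W d N φ js * Q d N js (2 * k)) * resBog d N L φ js z (2 * k) *
      (∑' l : ℕ, (gammaBog d N L φ js z k * resBog d N L φ js z (2 * k)) ^ l) *
      (Q d N js (2 * k) * Wstar d N φ js * Q d N js (2 * k + 2))

/-- `η = (1/√N!) (a*_0)^N Ω`: all particles in the zero mode. -/
def eta (d N : ℕ) : FockN d N :=
  open Classical in lp.single 2 (⟨Finsupp.single 0 N, by simp⟩ : Occ d N) (1 : ℂ)

/-- `f(z) = -z - ⟨η, W R_{N-2,N-2}(z) (∑_l [Γ_{N-2,N-2}(z) R_{N-2,N-2}(z)]^l) W* η⟩`, for even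
`N ≥ 2` (so that `2 (N / 2 - 1) = N - 2`). -/
def f (d N : ℕ) (L φ : ℝ) (js : Mode d) (z : ℝ) : ℂ :=
  -(z : ℂ) - inner ℂ (eta d N)
    ((W d N φ js * resBog d N L φ js z (N - 2) *
      (∑' l : ℕ, (gammaBog d N L φ js z (N / 2 - 1) * resBog d N L φ js z (N - 2)) ^ l) *
      Wstar d N φ js) (eta d N))

/-- All the operators that enter `f(z)` exist: for each even `i = 2 k` with `0 ≤ i ≤ N - 2`, the
operator `Q^{(i,i+1)} (H - z) Q^{(i,i+1)}` is boundedly invertible on the range of `Q^{(i,i+1)}`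
and the Neumann series `∑_l [Γ_{i,i}(z) R_{i,i}(z)]^l` converges in operator norm. -/
def FWellDefined (d N : ℕ) (L φ : ℝ) (js : Mode d) (z : ℝ) : Prop :=
  ∀ k : ℕ, 2 * k + 2 ≤ N →
    (∃ R, IsReducedResolvent (hBog d N L φ js) (Q d N js (2 * k)) (z : ℂ) R) ∧
    Summable (fun l : ℕ => (gammaBog d N L φ js z k * resBog d N L φ js z (2 * k)) ^ l)

/-- `ε = k_{j*}² / φ`. -/
def eps {d : ℕ} (L φ : ℝ) (js : Mode d) : ℝ := kSq L js / φ

/-- The Bogoliubov energy `E = -[k² + φ - √((k²)² + 2 φ k²)]` with `k² = k_{j*}²`. -/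
def eBog {d : ℕ} (L φ : ℝ) (js : Mode d) : ℝ :=
  -(kSq L js + φ - Real.sqrt ((kSq L js) ^ 2 + 2 * φ * kSq L js))

end

end ThreeModeBog

/-! In the occupation number basis `W` is a weighted shift: it moves a pair of particles between
the mode `0` and the modes `±j*`. Hence the operators of the Feshbach flow are all diagonal, the
Neumann series are geometric series of numbers, and `f z / φ`, as a function of `x = -z / φ`, is
the Schur complement of a tridiagonal matrix onto the condensate: along the chain
`(a, b, c) ↦ (a + 1, b + 1, c - 2)` of occupation numbers of `j*`, `-j*`, `0`, its diagonal is
`x + (ε + c / N) (a + b)` and its off-diagonal elements are those of `W / φ`.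

Up to `O(1 / N)` the Schur complements at `c = y N` follow the recursion
`σ(m) = x + (ε + y) m - y² (m + 2)² / (4 σ(m + 2))`, `m = a + b`. At the threshold
`x = 1 + ε - (1 + √ε) √(ε² + 2 ε)` the function `y (m (1 + ε + s) / 2 - s)`, `s = √(ε² + 2 ε)`, is
a subsolution of it, so all Schur complements off the condensate are positive there, and by
monotonicity for larger `x` as well. Since a Schur complement grows at least as fast as `x`, the
one at the condensate has at most one zero above the threshold. It is nonpositive slightly below
Bogoliubov's value `x = 1 + ε - s`, as one sees by comparing the chain of the condensate with the
solution `m / (4 r)` of slope `r ≈ (1 + ε - s) / 2`, and the intermediate value theorem provides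
the zero.
-/

namespace ThreeModeBog

section WeightedShifts

variable {A B C : Type*}

/-- The Hilbert space `ℓ²(A)`. -/
abbrev EllTwo (A : Type*) : Type _ := lp (fun _ : A => ℂ) 2

open Classical in
/-- The basis vector `δ_a` of `ℓ²(A)`. -/
noncomputable def basisVec (a : A) : EllTwo A := lp.single 2 a 1

theorem inner_basisVec (a : A) (ψ : EllTwo A) : inner ℂ (basisVec a) ψ = ψ a := by
  simp [basisVec, lp.inner_single_left]

theorem basisVec_apply_self (a : A) : basisVec a a = 1 := by
  simp [basisVec]

theorem basisVec_apply_ne {a a' : A} (h : a' ≠ a) : basisVec a a' = 0 := by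
  simp [basisVec, h]

/-- `T` is the weighted shift `(T ψ)(a) = w a * ψ (g a)` with real weights `w` along the partial
bijection `g`, where `T ψ` vanishes outside the domain of `g`. -/
def IsWeightedShift (T : EllTwo B →L[ℂ] EllTwo A) (g : A ≃. B) (w : A → ℝ) : Prop :=
  ∀ ψ a, T ψ a = (g a).elim 0 fun b => w a * ψ b

/-- `X` is the operator of multiplication by the real function `v`. -/
def IsDiagonal (X : EllTwo A →L[ℂ] EllTwo A) (v : A → ℝ) : Prop :=
  ∀ ψ a, X ψ a = v a * ψ a

namespace IsWeightedShift

variable {T : EllTwo B →L[ℂ] EllTwo A} {g : A ≃. B} {w : A → ℝ}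

theorem apply_of_mem (hT : IsWeightedShift T g w) {a : A} {b : B} (h : b ∈ g a) (ψ : EllTwo B) :
    T ψ a = w a * ψ b := by
  rw [hT, Option.mem_def.1 h, Option.elim_some]

theorem congr_weight {w' : A → ℝ} (hT : IsWeightedShift T g w)
    (h : ∀ a, ∀ b ∈ g a, w a = w' a) : IsWeightedShift T g w' := fun ψ a => by
  rw [hT]
  cases hg : g a with
  | none => rfl
  | some b => simp only [Option.elim_some, h a b hg]

theorem smul (hT : IsWeightedShift T g w) (c : ℝ) :
    IsWeightedShift ((c : ℂ) • T) g (c • w) := fun ψ a => by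
  change (c : ℂ) * T ψ a = _
  rw [hT]
  cases g a <;> simp [mul_assoc]

theorem comp {S : EllTwo C →L[ℂ] EllTwo B} {h : B ≃. C} {w' : B → ℝ}
    (hT : IsWeightedShift T g w) (hS : IsWeightedShift S h w') :
    IsWeightedShift (T ∘L S) (g.trans h) fun a => w a * (g a).elim 0 w' := fun ψ a => by
  change T (S ψ) a = ((g a).bind h).elim 0 _
  rw [hT]
  cases hg : g a with
  | none => rfl
  | some b =>
    simp only [hg, Option.elim_some, Option.bind_some, hS ψ b]
    cases h b <;> simp [mul_assoc]

theorem apply_basisVec_of_mem (hT : IsWeightedShift T g w) {a : A} {b : B} (h : b ∈ g a) :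
    T (basisVec b) = (w a : ℂ) • basisVec a := by
  ext a'
  change _ = (w a : ℂ) * basisVec a a'
  by_cases ha : a' = a
  · rw [ha, hT.apply_of_mem h, basisVec_apply_self, basisVec_apply_self]
  · rw [basisVec_apply_ne ha, mul_zero, hT]
    cases hg : g a' with
    | none => rfl
    | some b' =>
      have hb : b' ≠ b := fun hb => ha (g.inj (hb ▸ hg) h)
      simp only [Option.elim_some, basisVec_apply_ne hb, mul_zero]

theorem apply_basisVec_of_eq_none (hT : IsWeightedShift T g w) {b : B} (h : g.symm b = none) :
    T (basisVec b) = 0 := by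
  ext a
  rw [hT]
  cases hg : g a with
  | none => rfl
  | some b' =>
    have hb : b' ≠ b := by
      rintro rfl
      simp [g.eq_some_iff.2 hg] at h
    simp only [Option.elim_some, basisVec_apply_ne hb, mul_zero, lp.coeFn_zero, Pi.zero_apply]

theorem adjoint (hT : IsWeightedShift T g w) :
    IsWeightedShift T.adjoint g.symm fun b => (g.symm b).elim 0 w := fun ψ b => by
  rw [← inner_basisVec b, ContinuousLinearMap.adjoint_inner_right]
  cases h : g.symm b with
  | none => rw [hT.apply_basisVec_of_eq_none h, inner_zero_left, Option.elim_none]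
  | some a =>
    rw [hT.apply_basisVec_of_mem (g.eq_some_iff.1 h)]
    simp only [h, Option.elim_some, inner_smul_left, inner_basisVec, Complex.conj_ofReal]

theorem isDiagonal_conj (hT : IsWeightedShift T g w) {X : EllTwo B →L[ℂ] EllTwo B} {v : B → ℝ}
    (hX : IsDiagonal X v) :
    IsDiagonal (T ∘L X ∘L T.adjoint) fun a => (g a).elim 0 fun b => w a ^ 2 * v b := fun ψ a => by
  change T (X (T.adjoint ψ)) a = _
  rw [hT]
  cases h : g a with
  | none => simp [h]
  | some b =>
    have hb : g.symm b = some a := g.eq_some_iff.2 h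
    simp only [h, Option.elim_some, hX _ b, hT.adjoint ψ b, hb]
    push_cast
    ring

end IsWeightedShift

theorem abs_sub_div_le_div_add {q D l σ : ℝ} (hq : 0 < q) (hD : 0 ≤ D) (hqσ : q ≤ σ)
    (hσ : σ ≤ l) (hl : l ≤ σ + D) : |(l - σ) / l| ≤ D / (D + q) := by
  have hl0 : 0 < l := hq.trans_le (hqσ.trans hσ)
  rw [abs_of_nonneg (div_nonneg (sub_nonneg.2 hσ) hl0.le), div_le_div_iff₀ hl0 (by positivity)]
  have hle : (l - σ) * q ≤ D * σ := mul_le_mul (by linarith) hqσ hq.le hD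
  linarith

namespace IsDiagonal

variable {X Y : EllTwo A →L[ℂ] EllTwo A} {u v : A → ℝ}

theorem one : IsDiagonal (1 : EllTwo A →L[ℂ] EllTwo A) 1 := fun ψ a => by simp

theorem add (hX : IsDiagonal X u) (hY : IsDiagonal Y v) : IsDiagonal (X + Y) (u + v) :=
  fun ψ a => by
    change X ψ a + Y ψ a = _
    rw [hX, hY, Pi.add_apply, Complex.ofReal_add, add_mul]

theorem smul (hX : IsDiagonal X v) (c : ℝ) : IsDiagonal ((c : ℂ) • X) (c • v) := fun ψ a => by
  change (c : ℂ) * X ψ a = _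
  rw [hX, Pi.smul_apply, smul_eq_mul, Complex.ofReal_mul, mul_assoc]

theorem mul (hX : IsDiagonal X u) (hY : IsDiagonal Y v) : IsDiagonal (X * Y) (u * v) :=
  fun ψ a => by
    change X (Y ψ) a = _
    rw [hX, hY, Pi.mul_apply, Complex.ofReal_mul, mul_assoc]

theorem congr (hX : IsDiagonal X u) (h : ∀ a, u a = v a) : IsDiagonal X v := fun ψ a => by
  rw [hX, h]

theorem eq (hX : IsDiagonal X v) (hY : IsDiagonal Y v) : X = Y := by
  ext ψ a
  rw [hX, hY]

theorem inner_basisVec (hX : IsDiagonal X v) (a : A) :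
    inner ℂ (basisVec a) (X (basisVec a)) = v a := by
  rw [ThreeModeBog.inner_basisVec, hX, basisVec_apply_self, mul_one]

theorem norm_le (hX : IsDiagonal X v) {M : ℝ} (hM : 0 ≤ M) (hv : ∀ a, |v a| ≤ M) : ‖X‖ ≤ M := by
  refine X.opNorm_le_bound hM fun ψ => ?_
  refine lp.norm_le_of_forall_sum_le (by norm_num) (by positivity) fun s => ?_
  have hX' : ∀ a, X ψ a = shiftFun some (fun a => (v a : ℂ)) ψ a := hX ψ
  simp only [hX']
  exact shiftFun_sum_le some (fun _ _ _ h h' => Option.some.inj (h.trans h'.symm)) _ M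
    (fun a => by simpa using hv a) hM ψ s

theorem exists_of_bounded {M : ℝ} (hM : 0 ≤ M) (hv : ∀ a, |v a| ≤ M) :
    ∃ X : EllTwo A →L[ℂ] EllTwo A, IsDiagonal X v :=
  ⟨shiftCLM some (fun _ _ _ h h' => Option.some.inj (h.trans h'.symm)) (fun a => (v a : ℂ)) M
    (fun a => by simpa using hv a) hM, fun _ _ => rfl⟩

theorem summable_pow (hX : IsDiagonal X v) {C : ℝ} (hC0 : 0 ≤ C) (hC : C < 1)
    (hv : ∀ a, |v a| ≤ C) : Summable fun l : ℕ => X ^ l :=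
  summable_geometric_of_norm_lt_one ((hX.norm_le hC0 hv).trans_lt hC)

theorem tsum_pow (hX : IsDiagonal X v) {C : ℝ} (hC0 : 0 ≤ C) (hC : C < 1)
    (hv : ∀ a, |v a| ≤ C) : IsDiagonal (∑' l : ℕ, X ^ l) (1 - v)⁻¹ := fun ψ a => by
  have h : ((1 - X) * ∑' l : ℕ, X ^ l) ψ a = ψ a := by
    rw [mul_neg_geom_series X ((hX.norm_le hC0 hv).trans_lt hC), one_apply_eq_self]
  have hva : (1 : ℂ) - v a ≠ 0 := by
    have hlt : v a < 1 := (le_abs_self _).trans_lt ((hv a).trans_lt hC)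
    exact_mod_cast (sub_pos.2 hlt).ne'
  change (∑' l : ℕ, X ^ l) ψ a - X ((∑' l : ℕ, X ^ l) ψ) a = ψ a at h
  rw [hX] at h
  simp only [Pi.inv_apply, Pi.sub_apply, Pi.one_apply, Complex.ofReal_inv, Complex.ofReal_sub,
    Complex.ofReal_one]
  rw [eq_inv_mul_iff_mul_eq₀ hva]
  linear_combination h

theorem neumann {R G : EllTwo A →L[ℂ] EllTwo A} {S : Set A} {lam σ : A → ℝ} {q D : ℝ}
    (hR : IsDiagonal R (S.indicator lam⁻¹)) (hG : IsDiagonal G (S.indicator (lam - σ)))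
    (hq : 0 < q) (hD : 0 ≤ D) (hqσ : ∀ a ∈ S, q ≤ σ a) (hσ : ∀ a ∈ S, σ a ≤ lam a)
    (hlam : ∀ a ∈ S, lam a ≤ σ a + D) :
    (Summable fun l : ℕ => (G * R) ^ l) ∧
      IsDiagonal (R * ∑' l : ℕ, (G * R) ^ l) (S.indicator σ⁻¹) := by
  have hGR : IsDiagonal (G * R) (S.indicator ((lam - σ) / lam)) :=
    (hG.mul hR).congr fun a => by by_cases ha : a ∈ S <;> simp [ha, div_eq_mul_inv]
  have hC : D / (D + q) < 1 := (div_lt_one (by positivity)).2 (by linarith)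
  have hbound : ∀ a, |S.indicator ((lam - σ) / lam) a| ≤ D / (D + q) := fun a => by
    by_cases ha : a ∈ S
    · rw [Set.indicator_of_mem ha]
      exact abs_sub_div_le_div_add hq hD (hqσ a ha) (hσ a ha) (hlam a ha)
    · rw [Set.indicator_of_notMem ha, abs_zero]
      positivity
  refine ⟨hGR.summable_pow (by positivity) hC hbound,
    (hR.mul (hGR.tsum_pow (by positivity) hC hbound)).congr fun a => ?_⟩
  by_cases ha : a ∈ S
  · have hlama : lam a ≠ 0 := (hq.trans_le ((hqσ a ha).trans (hσ a ha))).ne'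
    simp only [Pi.mul_apply, Pi.inv_apply, Pi.sub_apply, Pi.one_apply, Pi.div_apply,
      Set.indicator_of_mem ha]
    rw [one_sub_div hlama, sub_sub_cancel, inv_div, inv_mul_eq_div, div_div_cancel_left' hlama]
  · simp only [Pi.mul_apply, Set.indicator_of_notMem ha, zero_mul]

end IsDiagonal

section ReducedResolvent

theorem IsReducedResolvent.unique {E : Type*} [NormedAddCommGroup E] [NormedSpace ℂ E]
    {H : E →ₗ.[ℂ] E} {P R R' : E →L[ℂ] E} {z : ℂ} (h : IsReducedResolvent H P z R)
    (h' : IsReducedResolvent H P z R') : R = R' := by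
  ext ψ
  have hPR : P (R' ψ) = R' ψ := DFunLike.congr_fun h'.left_proj ψ
  have hRP : R (P ψ) = R ψ := DFunLike.congr_fun h.right_proj ψ
  rw [← hRP, ← h'.right_inv]
  exact h.left_inv ⟨R' ψ, h'.mem_domain ψ⟩ hPR

theorem IsReducedResolvent.reducedResolvent_eq {E : Type*} [NormedAddCommGroup E]
    [NormedSpace ℂ E] {H : E →ₗ.[ℂ] E} {P R : E →L[ℂ] E} {z : ℂ}
    (h : IsReducedResolvent H P z R) : reducedResolvent H P z = R := by
  have hex : ∃ R, IsReducedResolvent H P z R := ⟨R, h⟩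
  rw [reducedResolvent, dif_pos hex]
  exact hex.choose_spec.unique h

theorem isReducedResolvent_of_isDiagonal {H : EllTwo A →ₗ.[ℂ] EllTwo A}
    {P R : EllTwo A →L[ℂ] EllTwo A} {S : Set A} {lam : A → ℝ} {z : ℂ}
    (hP : IsDiagonal P (S.indicator 1)) (hR : IsDiagonal R (S.indicator lam⁻¹))
    (hlam : ∀ a ∈ S, lam a ≠ 0) (hdom : ∀ ψ, R ψ ∈ H.domain)
    (hH : ∀ ψ : H.domain, P ψ = ψ → ∀ a ∈ S, (H ψ - z • (ψ : EllTwo A)) a = lam a * ψ.1 a) :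
    IsReducedResolvent H P z R := by
  have hPR : P * R = R := (hP.mul hR).eq <| hR.congr fun a => by
    by_cases ha : a ∈ S <;> simp [ha]
  have hRP : R * P = R := (hR.mul hP).eq <| hR.congr fun a => by
    by_cases ha : a ∈ S <;> simp [ha]
  refine ⟨hPR, hRP, hdom, fun ψ => ?_, fun ψ hψ => ?_⟩
  · ext a
    rw [hP, hP]
    by_cases ha : a ∈ S
    · rw [hH ⟨R ψ, hdom ψ⟩ (DFunLike.congr_fun hPR ψ) a ha, hR]
      have hne : (lam a : ℂ) ≠ 0 := Complex.ofReal_ne_zero.2 (hlam a ha)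
      simp [ha, hne]
    · simp [ha]
  · ext a
    rw [hR, hP]
    by_cases ha : a ∈ S
    · rw [hH ψ hψ a ha]
      have hne : (lam a : ℂ) ≠ 0 := Complex.ofReal_ne_zero.2 (hlam a ha)
      simp [ha, hne]
    · rw [← hψ, hP]
      simp [ha]

end ReducedResolvent

end WeightedShifts

section OccupationNumbers

variable {d N : ℕ} {js : Mode d} {L : ℝ}

theorem mem_addOne {j : Mode d} {m : Occ d (N - 1)} {n : Occ d N} :
    n ∈ addOne d N j m ↔ n.1 = m.1 + Finsupp.single j 1 := by
  unfold addOne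
  split_ifs with h
  · simp [Subtype.ext_iff, eq_comm]
  · simp only [Option.mem_def, reduceCtorEq, false_iff]
    exact fun hn => h (hn ▸ n.2)

theorem tsub_single_add_single {j : Mode d} {n : Mode d →₀ ℕ} (h : n j ≠ 0) :
    n - Finsupp.single j 1 + Finsupp.single j 1 = n :=
  tsub_add_cancel_of_le (Finsupp.single_le_iff.2 (Nat.one_le_iff_ne_zero.2 h))

/-- The partial bijection `m ↦ m + δ_j` from `N - 1` to `N` particles; annihilation and creation
operators are weighted shifts along it and along its inverse. -/
noncomputable def addParticle (d N : ℕ) (j : Mode d) : Occ d (N - 1) ≃. Occ d N where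
  toFun := addOne d N j
  invFun n := if h : n.1 j = 0 then none else
    some ⟨n.1 - Finsupp.single j 1, by
      have hdeg := congrArg Finsupp.degree (tsub_single_add_single h)
      rw [map_add, Finsupp.degree_single, n.2] at hdeg
      omega⟩
  inv m n := by
    refine Iff.trans ?_ mem_addOne.symm
    split_ifs with h
    · refine iff_of_false not_false fun hn => ?_
      simp [hn] at h
    · simp only [Option.some.injEq, Subtype.ext_iff]
      constructor
      · intro hm
        rw [← hm, tsub_single_add_single h]
      · intro hn
        rw [hn, add_tsub_cancel_right]

theorem mem_addParticle {j : Mode d} {m : Occ d (N - 1)} {n : Occ d N} :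
    n ∈ addParticle d N j m ↔ n.1 = m.1 + Finsupp.single j 1 :=
  mem_addOne

theorem addParticle_symm_eq_none {j : Mode d} {n : Occ d N} :
    (addParticle d N j).symm n = none ↔ n.1 j = 0 := by
  change dite _ _ _ = none ↔ _
  simp

theorem exists_mem_addParticle (hN : 0 < N) (j : Mode d) (m : Occ d (N - 1)) :
    ∃ n, n ∈ addParticle d N j m := by
  refine ⟨⟨m.1 + Finsupp.single j 1, ?_⟩, mem_addParticle.2 rfl⟩
  rw [map_add, Finsupp.degree_single, m.2]
  omega

theorem exists_mem_addParticle_symm {j : Mode d} {n : Occ d N} (h : n.1 j ≠ 0) :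
    ∃ m, m ∈ (addParticle d N j).symm n :=
  Option.ne_none_iff_exists'.1 (addParticle_symm_eq_none.not.2 h)

theorem isWeightedShift_annih (j : Mode d) :
    IsWeightedShift (annih d N j) (addParticle d N j) fun m => √((m.1 j : ℝ) + 1) :=
  fun _ _ => rfl

theorem isWeightedShift_create (j : Mode d) :
    IsWeightedShift (create d N j) (addParticle d N j).symm fun n => √(n.1 j : ℝ) :=
  (isWeightedShift_annih j).adjoint.congr_weight fun n m hm => by
    have hn : n.1 = m.1 + Finsupp.single j 1 := mem_addParticle.1 (PEquiv.mem_iff_mem _ |>.1 hm)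
    simp [Option.mem_def.1 hm, hn]

theorem isDiagonal_num (j : Mode d) : IsDiagonal (num d N j) fun n => (n.1 j : ℝ) := by
  have h := (isWeightedShift_create (N := N) j).isDiagonal_conj IsDiagonal.one
  rw [create, ContinuousLinearMap.adjoint_adjoint] at h
  refine IsDiagonal.congr (X := num d N j) h fun n => ?_
  cases hm : (addParticle d N j).symm n with
  | none => simp [addParticle_symm_eq_none.1 hm]
  | some m => simp

/-- The partial bijection `n ↦ n - 2 δ_0 + δ_{j*} + δ_{-j*}` along which `W` is a weighted shift,
defined if `2 ≤ n_0`. -/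
noncomputable def promote (js : Mode d) : Occ d N ≃. Occ d N :=
  (addParticle d N 0).symm.trans <| (addParticle d (N - 1) 0).symm.trans <|
    (addParticle d (N - 1) js).trans (addParticle d N (-js))

theorem mem_promote {n n' : Occ d N} : n' ∈ promote js n ↔
    ∃ (m : Occ d (N - 1)) (m' : Occ d (N - 1 - 1)) (p : Occ d (N - 1)),
      n.1 = m.1 + Finsupp.single 0 1 ∧ m.1 = m'.1 + Finsupp.single 0 1 ∧
      p.1 = m'.1 + Finsupp.single js 1 ∧ n'.1 = p.1 + Finsupp.single (-js) 1 := by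
  simp only [promote, PEquiv.mem_trans, PEquiv.mem_iff_mem, mem_addParticle]
  constructor
  · rintro ⟨m, hm, m', hm', p, hp, hn'⟩
    exact ⟨m, m', p, hm, hm', hp, hn'⟩
  · rintro ⟨m, m', p, hm, hm', hp, hn'⟩
    exact ⟨m, hm, m', hm', p, hp, hn'⟩

theorem exists_mem_promote {n : Occ d N} (h : 2 ≤ n.1 0) : ∃ n', n' ∈ promote js n := by
  have hN : n.1 0 ≤ N := (Finsupp.le_degree 0 n.1).trans_eq n.2
  obtain ⟨m, hm⟩ := exists_mem_addParticle_symm (j := 0) (n := n) (by omega)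
  have hm0 : n.1 0 = m.1 0 + 1 := by
    simp [mem_addParticle.1 ((PEquiv.mem_iff_mem _).1 hm)]
  obtain ⟨m', hm'⟩ := exists_mem_addParticle_symm (j := 0) (n := m) (by omega)
  obtain ⟨p, hp⟩ := exists_mem_addParticle (by omega) js m'
  obtain ⟨n', hn'⟩ := exists_mem_addParticle (by omega) (-js) p
  simp only [promote, PEquiv.mem_trans]
  exact ⟨n', m, hm, m', hm', p, hp, hn'⟩

theorem neg_ne_self_of_ne_zero {j : Mode d} (hj : j ≠ 0) : -j ≠ j := neg_eq_self.not.2 hj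

theorem promote_apply_zero (hjs : js ≠ 0) {n n' : Occ d N} (h : n' ∈ promote js n) :
    n.1 0 = n'.1 0 + 2 := by
  obtain ⟨m, m', p, hm, hm', hp, hn'⟩ := mem_promote.1 h
  simp [hm, hm', hp, hn', hjs]

theorem promote_apply_pos (hjs : js ≠ 0) {n n' : Occ d N} (h : n' ∈ promote js n) :
    n'.1 js = n.1 js + 1 := by
  obtain ⟨m, m', p, hm, hm', hp, hn'⟩ := mem_promote.1 h
  simp [hm, hm', hp, hn', hjs, neg_ne_self_of_ne_zero hjs]

theorem promote_apply_neg (hjs : js ≠ 0) {n n' : Occ d N} (h : n' ∈ promote js n) :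
    n'.1 (-js) = n.1 (-js) + 1 := by
  obtain ⟨m, m', p, hm, hm', hp, hn'⟩ := mem_promote.1 h
  simp [hm, hm', hp, hn', hjs, (neg_ne_self_of_ne_zero hjs).symm]

theorem lt_two_of_promote_eq_none {n : Occ d N} (h : promote js n = none) : n.1 0 < 2 := by
  by_contra! hn
  obtain ⟨n', hn'⟩ := exists_mem_promote (js := js) hn
  exact Option.some_ne_none _ (hn'.symm.trans h)

theorem occ_add_le (hjs : js ≠ 0) (n : Occ d N) : n.1 js + n.1 (-js) + n.1 0 ≤ N := by
  classical
  have hneg : -js ≠ 0 := neg_ne_zero.2 hjs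
  calc n.1 js + n.1 (-js) + n.1 0 = ∑ i ∈ ({js, -js, 0} : Finset (Mode d)), n.1 i := by
        rw [Finset.sum_insert (by simp [(neg_ne_self_of_ne_zero hjs).symm, hjs]),
          Finset.sum_pair hneg, add_assoc]
    _ ≤ ∑ i ∈ {js, -js, 0} ∪ n.1.support, n.1 i :=
        Finset.sum_le_sum_of_subset Finset.subset_union_left
    _ = ∑ i ∈ n.1.support, n.1 i := (Finset.sum_subset Finset.subset_union_right
        fun _ _ hx => Finsupp.notMem_support_iff.1 hx).symm
    _ = N := n.2

theorem kSq_nonneg (j : Mode d) : 0 ≤ kSq L j := Finset.sum_nonneg fun _ _ => sq_nonneg _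

theorem kSq_zero : kSq L (0 : Mode d) = 0 := by simp [kSq]

theorem kSq_pos (hL : 0 < L) (hjs : js ≠ 0) : 0 < kSq L js := by
  obtain ⟨i, hi⟩ := Function.ne_iff.1 hjs
  have hi' : (js i : ℝ) ≠ 0 := Int.cast_ne_zero.2 hi
  refine Finset.sum_pos' (fun _ _ => sq_nonneg _) ⟨i, Finset.mem_univ _, ?_⟩
  have := Real.pi_pos
  positivity

theorem kinOther_nonneg (n : Occ d N) : 0 ≤ kinOther L js n := by
  refine Finset.sum_nonneg fun j _ => ?_
  dsimp only
  split_ifs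
  · exact le_rfl
  · exact mul_nonneg (kSq_nonneg _) (Nat.cast_nonneg _)

theorem kinOther_add_single {M : ℕ} {m : Occ d M} {n : Occ d N} {j : Mode d}
    (h : n.1 = m.1 + Finsupp.single j 1) :
    kinOther L js n = kinOther L js m + if j = js ∨ j = -js then 0 else kSq L j := by
  unfold kinOther
  rw [h, Finsupp.sum_add_index' (by simp), Finsupp.sum_single_index (by simp), Nat.cast_one,
    mul_one]
  intro i a b
  split_ifs
  · rw [add_zero]
  · rw [Nat.cast_add, mul_add]

theorem kinOther_promote {n n' : Occ d N} (h : n' ∈ promote js n) :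
    kinOther L js n' = kinOther L js n := by
  obtain ⟨m, m', p, hm, hm', hp, hn'⟩ := mem_promote.1 h
  rw [kinOther_add_single hm, kinOther_add_single hm', kinOther_add_single hn',
    kinOther_add_single hp]
  simp [kSq_zero]

/-- The matrix element `⟨n, W n'⟩`, where `n'` is the promotion of `n`. -/
noncomputable def wCoeff (φ : ℝ) (js : Mode d) (n : Occ d N) : ℝ :=
  φ / N * (√(n.1 0 : ℝ) * √((n.1 0 : ℝ) - 1) * √((n.1 js : ℝ) + 1) * √((n.1 (-js) : ℝ) + 1))

theorem isWeightedShift_W (hjs : js ≠ 0) (φ : ℝ) :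
    IsWeightedShift (W d N φ js) (promote js) (wCoeff φ js) := by
  have hshift := ((isWeightedShift_create (N := N) 0).comp <| (isWeightedShift_create 0).comp <|
    (isWeightedShift_annih js).comp (isWeightedShift_annih (N := N) (-js))).smul (φ / N)
  refine hshift.congr_weight fun n n' hn' => ?_
  simp only [PEquiv.mem_trans] at hn'
  obtain ⟨m, hm, m', hm', p, hp, -⟩ := hn'
  have hnm := mem_addParticle.1 ((PEquiv.mem_iff_mem _).1 hm)
  have hmm' := mem_addParticle.1 ((PEquiv.mem_iff_mem _).1 hm')
  have hpm' := mem_addParticle.1 hp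
  have hm0 : (m.1 0 : ℝ) = n.1 0 - 1 := by simp [hnm]
  have hmjs : m'.1 js = n.1 js := by simp [hnm, hmm', hjs]
  have hpjs : p.1 (-js) = n.1 (-js) := by
    simp [hnm, hmm', hpm', hjs, (neg_ne_self_of_ne_zero hjs).symm]
  simp only [Option.mem_def] at hm hm' hp
  simp only [Pi.smul_apply, smul_eq_mul, wCoeff, hm, hm', hp, Option.elim_some, hm0, hmjs, hpjs]
  ring

theorem wCoeff_sq (φ : ℝ) (js : Mode d) {n : Occ d N} (h : 2 ≤ n.1 0) :
    wCoeff φ js n ^ 2 =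
      (φ / N) ^ 2 * (n.1 0 * ((n.1 0 : ℝ) - 1) * ((n.1 js : ℝ) + 1) * ((n.1 (-js) : ℝ) + 1)) := by
  have h' : (2 : ℝ) ≤ n.1 0 := by exact_mod_cast h
  simp only [wCoeff, mul_pow]
  rw [Real.sq_sqrt (by positivity), Real.sq_sqrt (by linarith), Real.sq_sqrt (by positivity),
    Real.sq_sqrt (by positivity)]

/-- The configurations with `N - i` or `N - i - 1` particles in the modes `±j*`. -/
def sector (js : Mode d) (i : ℕ) : Set (Occ d N) :=
  {n | n.1 js + n.1 (-js) + i = N ∨ n.1 js + n.1 (-js) + i + 1 = N}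

theorem mem_sector {i : ℕ} {n : Occ d N} : n ∈ sector js i ↔
    n.1 js + n.1 (-js) + i = N ∨ n.1 js + n.1 (-js) + i + 1 = N :=
  Iff.rfl

theorem isDiagonal_Q (i : ℕ) : IsDiagonal (Q d N js i) ((sector js i).indicator 1) := fun ψ n => by
  change (if n.1 js + n.1 (-js) + i = N ∨ n.1 js + n.1 (-js) + i + 1 = N then 1 else 0) * ψ n = _
  by_cases hn : n ∈ sector js i
  · rw [if_pos (mem_sector.1 hn)]
    simp [hn]
  · rw [if_neg (mem_sector.not.1 hn)]
    simp [hn]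

theorem promote_mem_sector_iff (hjs : js ≠ 0) {i : ℕ} {n n' : Occ d N} (h : n' ∈ promote js n) :
    n' ∈ sector js i ↔ n ∈ sector js (i + 2) := by
  simp only [mem_sector, promote_apply_pos hjs h, promote_apply_neg hjs h]
  omega

end OccupationNumbers

section SchurComplements

/-- Diagonal matrix element of `(H - z) / φ` on a product state with `a`, `b`, `c` particles in the
modes `j*`, `-j*`, `0`, where `φ x` is the kinetic energy of the other modes minus `z`. -/
noncomputable def diagElem (ε : ℝ) (N : ℕ) (x : ℝ) (a b c : ℕ) : ℝ :=
  x + (ε + c / N) * (a + b)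

/-- Schur complement of `(H - z) / φ` onto a product state along the chain of states reached from
it by moving pairs of particles from the mode `0` to the modes `±j*`; parameters as in
`diagElem`. -/
noncomputable def schur (ε : ℝ) (N : ℕ) (x : ℝ) : ℕ → ℕ → ℕ → ℝ
  | a, b, 0 => diagElem ε N x a b 0
  | a, b, 1 => diagElem ε N x a b 1
  | a, b, c + 2 => diagElem ε N x a b (c + 2) -
      (((c : ℝ) + 2) * (c + 1) * (a + 1) * (b + 1)) / N ^ 2 / schur ε N x (a + 1) (b + 1) c

/-- Away from the condensate state all Schur complements are at least `p > 0`, so that every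
inverse in the recursion exists. -/
structure HasSchurGap (ε : ℝ) (N : ℕ) (x p : ℝ) : Prop where
  pos : 0 < p
  le_schur : ∀ a b c : ℕ, 1 ≤ a + b → a + b + c ≤ N → p ≤ schur ε N x a b c

variable {ε x y p : ℝ} {N : ℕ}

namespace HasSchurGap

theorem schur_pos (h : HasSchurGap ε N x p) {a b c : ℕ} (hab : 1 ≤ a + b) (hN : a + b + c ≤ N) :
    0 < schur ε N x a b c :=
  h.pos.trans_le (h.le_schur a b c hab hN)

theorem schur_le_diagElem (h : HasSchurGap ε N x p) {a b c : ℕ} (hN : a + b + c ≤ N) :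
    schur ε N x a b c ≤ diagElem ε N x a b c := by
  match c with
  | 0 => rw [schur]
  | 1 => rw [schur]
  | c + 2 =>
    have hpos : 0 < schur ε N x (a + 1) (b + 1) c := h.schur_pos (by omega) (by omega)
    rw [schur, sub_le_self_iff]
    positivity

theorem schur_add_sub_le (h : HasSchurGap ε N x p) (hxy : x ≤ y) :
    ∀ {c a b : ℕ}, a + b + c ≤ N → schur ε N x a b c + (y - x) ≤ schur ε N y a b c := by
  intro c
  induction c using Nat.twoStepInduction with
  | zero => intros; simp only [schur, diagElem]; linarith
  | one => intros; simp only [schur, diagElem]; linarith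
  | more c ih _ =>
    intro a b hN
    have hpos : 0 < schur ε N x (a + 1) (b + 1) c := h.schur_pos (by omega) (by omega)
    have hle : schur ε N x (a + 1) (b + 1) c ≤ schur ε N y (a + 1) (b + 1) c :=
      (le_add_of_nonneg_right (sub_nonneg.2 hxy)).trans (ih (by omega))
    have hdiv : (((c : ℝ) + 2) * (c + 1) * (a + 1) * (b + 1)) / N ^ 2 /
        schur ε N y (a + 1) (b + 1) c ≤ (((c : ℝ) + 2) * (c + 1) * (a + 1) * (b + 1)) / N ^ 2 /
        schur ε N x (a + 1) (b + 1) c := by gcongr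
    simp only [schur, diagElem]
    linarith

theorem mono (h : HasSchurGap ε N x p) (hxy : x ≤ y) : HasSchurGap ε N y p where
  pos := h.pos
  le_schur a b c hab hN := by linarith [h.le_schur a b c hab hN, h.schur_add_sub_le hxy hN]

theorem strictMonoOn_schur (h : HasSchurGap ε N x p) {a b c : ℕ} (hN : a + b + c ≤ N) :
    StrictMonoOn (fun y => schur ε N y a b c) (Set.Ici x) := fun y hy y' _ hyy' => by
  have := (h.mono hy).schur_add_sub_le hyy'.le hN
  dsimp only
  linarith

theorem continuousOn_schur (h : HasSchurGap ε N x p) :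
    ∀ {c a b : ℕ}, a + b + c ≤ N → ContinuousOn (fun y => schur ε N y a b c) (Set.Ici x) := by
  intro c
  induction c using Nat.twoStepInduction with
  | zero => intros; simp only [schur, diagElem]; fun_prop
  | one => intros; simp only [schur, diagElem]; fun_prop
  | more c ih _ =>
    intro a b hN
    simp only [schur, diagElem]
    refine ContinuousOn.sub (by fun_prop) (ContinuousOn.div (by fun_prop) (ih (by omega)) ?_)
    exact fun y hy => ((h.mono hy).schur_pos (by omega) (by omega)).ne'

end HasSchurGap

end SchurComplements

section BogoliubovRecursion

/-- Bogoliubov's excitation energy `√(ε² + 2ε)` of the modes `±j*`, in units of `φ`. -/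
noncomputable def dispersion (ε : ℝ) : ℝ := √(ε ^ 2 + 2 * ε)

/-- `-z_max / φ`. -/
noncomputable def threshold (ε : ℝ) : ℝ := 1 + ε - dispersion ε - √ε * dispersion ε

variable {ε : ℝ}

theorem dispersion_sq (hε : 0 ≤ ε) : dispersion ε ^ 2 = ε ^ 2 + 2 * ε :=
  Real.sq_sqrt (by positivity)

theorem dispersion_pos (hε : 0 < ε) : 0 < dispersion ε := Real.sqrt_pos.2 (by positivity)

theorem le_dispersion (hε : 0 ≤ ε) : ε ≤ dispersion ε := Real.le_sqrt_of_sq_le (by linarith)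

theorem sqrt_le_dispersion (hε : 0 ≤ ε) : 1.4 * √ε ≤ dispersion ε := by
  refine Real.le_sqrt_of_sq_le ?_
  rw [mul_pow, Real.sq_sqrt hε]
  nlinarith

theorem dispersion_le_sqrt (hε : 0 ≤ ε) (hε' : ε ≤ 1 / 100) : dispersion ε ≤ 1.5 * √ε := by
  refine Real.sqrt_le_iff.2 ⟨by positivity, ?_⟩
  rw [mul_pow, Real.sq_sqrt hε]
  nlinarith

theorem sqrt_le_tenth (hε' : ε ≤ 1 / 100) : √ε ≤ 1 / 10 :=
  Real.sqrt_le_iff.2 ⟨by norm_num, by linarith⟩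

/-- The slope `r = (1 + ε + s) / 2` solves `4 r (1 + ε - r) = 1`, the fixed-point equation of the
recursion for large occupation of `±j*`. -/
theorem bogoliubov_subsolution (hε : 0 < ε) (hε' : ε ≤ 1 / 100) {M : ℝ} (hM : 3 ≤ M) :
    M ^ 2 / (4 * (M * ((1 + ε + dispersion ε) / 2) - dispersion ε)) ≤
      M * ((1 + ε - dispersion ε) / 2) + dispersion ε - √ε * dispersion ε := by
  have hs2 := dispersion_sq hε.le
  have hs := dispersion_pos hε
  have hs1 := sqrt_le_dispersion hε.le
  have hs' := dispersion_le_sqrt hε.le hε'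
  have he := sqrt_le_tenth hε'
  have he0 := Real.sqrt_pos.2 hε
  generalize dispersion ε = s at *
  generalize √ε = e at *
  have hP : 0 < 4 * (M * ((1 + ε + s) / 2) - s) := by nlinarith
  rw [div_le_iff₀ hP]
  have hlin : 2 * s * (1 - e) ≤ M * (2 * s - (1 + ε + s) * e) := by
    have h2 : 0 ≤ 2 * s - (1 + ε + s) * e := by nlinarith
    nlinarith
  have hquad : M ^ 2 * ((1 + ε) ^ 2 - s ^ 2) = M ^ 2 := by rw [hs2]; ring
  linear_combination 2 * s * hlin - hquad

/-- Lower bound of `schur_lower` passes from `y = c / N` to the next Schur complement, whose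
contribution is at most `y * A`; here `m = a + b` and `n = 1 / N`. -/
theorem lower_step (hε : 0 < ε) (hε' : ε ≤ 1 / 100) {m A y n : ℝ} (hm : 1 ≤ m) (hn : 0 ≤ n)
    (hy0 : 0 ≤ y) (hy : y + m * n ≤ 1)
    (hA : A ≤ (m + 2) ^ 2 / (4 * ((m + 2) * ((1 + ε + dispersion ε) / 2) - dispersion ε))) :
    (y + n) * (m * ((1 + ε + dispersion ε) / 2) - dispersion ε) ≤
      threshold ε + (ε + y) * m - y * A := by
  have hA' := hA.trans (bogoliubov_subsolution hε hε' (by linarith))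
  have hs := dispersion_pos hε
  have hs' := dispersion_le_sqrt hε.le hε'
  have he := sqrt_le_tenth hε'
  have he0 := Real.sqrt_pos.2 hε
  rw [threshold]
  generalize dispersion ε = s at *
  generalize √ε = e at *
  have htop : (1 + ε + s) / 2 ≤ ε * m + (1 + ε - s - e * s) := by nlinarith
  calc (y + n) * (m * ((1 + ε + s) / 2) - s)
      ≤ y * (m * ((1 + ε + s) / 2) - s) + m * n * ((1 + ε + s) / 2) := by
        nlinarith [mul_nonneg hn hs.le]
    _ ≤ y * (m * ((1 + ε + s) / 2) - s) + (1 - y) * (ε * m + (1 + ε - s - e * s)) := by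
        gcongr
        · linarith [mul_nonneg (zero_le_one.trans hm) hn]
        · linarith
    _ = (1 + ε - s - e * s) + (ε + y) * m -
          y * ((m + 2) * ((1 + ε - s) / 2) + s - e * s) := by ring
    _ ≤ (1 + ε - s - e * s) + (ε + y) * m - y * A := by gcongr

theorem lower_step_diagElem (hε : 0 < ε) (hε' : ε ≤ 1 / 100) {N a b c : ℕ} (hab : 1 ≤ a + b)
    (hN : a + b + c ≤ N) {A : ℝ} (hA : A ≤ (a + b + 2) ^ 2 /
      (4 * ((a + b + 2) * ((1 + ε + dispersion ε) / 2) - dispersion ε))) :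
    ((c : ℝ) / N + 1 / N) * ((a + b) * ((1 + ε + dispersion ε) / 2) - dispersion ε) ≤
      diagElem ε N (threshold ε) a b c - c / N * A := by
  have hNpos : (0 : ℝ) < N := by exact_mod_cast (by omega : 0 < N)
  refine lower_step hε hε' (by exact_mod_cast hab) (by positivity) (by positivity) ?_ hA
  rw [mul_one_div, ← add_div, div_le_one hNpos]
  exact_mod_cast (by omega : c + (a + b) ≤ N)

theorem slope_pos (hε : 0 < ε) (hε' : ε ≤ 1 / 100) {m : ℝ} (hm : 1 ≤ m) :
    0 < m * ((1 + ε + dispersion ε) / 2) - dispersion ε := by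
  have hs := dispersion_pos hε
  have hs' : dispersion ε ≤ 0.15 := by
    linarith [dispersion_le_sqrt hε.le hε', sqrt_le_tenth hε']
  nlinarith

theorem schur_lower (hε : 0 < ε) (hε' : ε ≤ 1 / 100) {N : ℕ} :
    ∀ {c a b : ℕ}, 1 ≤ a + b → a + b + c ≤ N →
      ((c : ℝ) / N + 1 / N) * ((a + b) * ((1 + ε + dispersion ε) / 2) - dispersion ε) ≤
        schur ε N (threshold ε) a b c := by
  have hbase {c a b : ℕ} (hab : 1 ≤ a + b) (hN : a + b + c ≤ N) :
      ((c : ℝ) / N + 1 / N) * ((a + b) * ((1 + ε + dispersion ε) / 2) - dispersion ε) ≤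
        diagElem ε N (threshold ε) a b c := by
    have hpos := slope_pos hε hε' (m := a + b + 2) (by exact_mod_cast (by omega : 1 ≤ a + b + 2))
    simpa using lower_step_diagElem hε hε' hab hN (A := 0) (by positivity)
  intro c
  induction c using Nat.twoStepInduction with
  | zero => exact fun hab hN => by simpa only [schur] using hbase hab hN
  | one => exact fun hab hN => by simpa only [schur] using hbase hab hN
  | more c ih _ =>
    intro a b hab hN
    have hNpos : (0 : ℝ) < N := by exact_mod_cast (by omega : 0 < N)
    have hpos := slope_pos hε hε' (m := a + b + 2) (by exact_mod_cast (by omega : 1 ≤ a + b + 2))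
    have hnext := ih (a := a + 1) (b := b + 1) (by omega) (by omega)
    refine (lower_step_diagElem hε hε' hab hN le_rfl).trans ?_
    rw [schur]
    refine sub_le_sub_left ?_ _
    push_cast at hnext ⊢
    rw [show (a : ℝ) + 1 + (b + 1) = a + b + 2 by ring] at hnext
    set P := ((a : ℝ) + b + 2) * ((1 + ε + dispersion ε) / 2) - dispersion ε
    calc ((c : ℝ) + 2) * (c + 1) * (a + 1) * (b + 1) / N ^ 2 /
          schur ε N (threshold ε) (a + 1) (b + 1) c
        ≤ ((c : ℝ) + 2) * (c + 1) * (a + 1) * (b + 1) / N ^ 2 / ((c / N + 1 / N) * P) := by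
          gcongr
      _ = (c + 2) / N * (4 * ((a + 1) * (b + 1)) / (4 * P)) := by field_simp
      _ ≤ (c + 2) / N * ((a + b + 2) ^ 2 / (4 * P)) := by
          gcongr
          nlinarith [sq_nonneg ((a : ℝ) - b)]

theorem hasSchurGap_threshold (hε : 0 < ε) (hε' : ε ≤ 1 / 100) {N : ℕ} (hN : 0 < N) :
    HasSchurGap ε N (threshold ε) (1 / N * ((1 + ε + dispersion ε) / 2 - dispersion ε)) where
  pos := by
    have hpos := slope_pos hε hε' le_rfl
    rw [one_mul] at hpos
    positivity
  le_schur a b c hab habc := by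
    refine le_trans ?_ (schur_lower hε hε' hab habc)
    have hpos := slope_pos hε hε' le_rfl
    have hab' : (1 : ℝ) ≤ a + b := by exact_mod_cast hab
    have hs := dispersion_pos hε
    rw [one_mul] at hpos
    gcongr
    · exact le_add_of_nonneg_left (by positivity)
    · exact le_mul_of_one_le_left (by positivity) hab'

end BogoliubovRecursion

section CondensateChain

variable {ε r : ℝ} {N : ℕ}

/-- One step of `schur_condensate_le`, with `m = 2 a` and `n = 1 / N`. -/
theorem condensate_step {n m : ℝ} (hn : 0 ≤ n) (hm : 0 ≤ m) (hr0 : 0 < r) (hr : r ≤ 1 / 2)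
    (hrN : 4 * r * (1 + ε - r + 5 / 2 * n) ≤ 1) :
    2 * r - n + (ε + (1 - m * n)) * m - (1 - m * n) * (1 - m * n - n) * (r * (m + 2)) ≤
      m * (1 / (4 * r)) := by
  have hslope : 1 + ε - r + 5 / 2 * n ≤ 1 / (4 * r) :=
    (le_div_iff₀' (by positivity)).2 hrN
  have hquad : 1 - 2 * (m * n) - n ≤ (1 - m * n) * (1 - m * n - n) := by
    linarith [mul_nonneg (mul_nonneg hm hn) hn, sq_nonneg (m * n)]
  calc 2 * r - n + (ε + (1 - m * n)) * m - (1 - m * n) * (1 - m * n - n) * (r * (m + 2))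
      ≤ 2 * r - n + (ε + (1 - m * n)) * m - (1 - 2 * (m * n) - n) * (r * (m + 2)) := by gcongr
    _ = m * (1 + ε - r + 5 * r * n) - (1 - 2 * r) * n * (1 + m ^ 2) := by ring
    _ ≤ m * (1 + ε - r + 5 / 2 * n) := by
        have hdrop : 0 ≤ (1 - 2 * r) * n * (1 + m ^ 2) :=
          mul_nonneg (mul_nonneg (by linarith) hn) (by positivity)
        have hrn : 5 * r * n ≤ 5 / 2 * n := by gcongr; linarith
        have := mul_le_mul_of_nonneg_left hrn hm
        linarith
    _ ≤ m * (1 / (4 * r)) := by gcongr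

theorem schur_condensate_zero_le {a : ℕ} (ha : 1 ≤ a) (hr0 : 0 < r) (hr : r ≤ 1 / 2)
    (hrN : 4 * r * (1 + ε - r + 5 / 2 * (1 / N)) ≤ 1) :
    schur ε N (2 * r - 1 / N) a a 0 ≤ a / (2 * r) := by
  have hslope : 1 + ε - r + 5 / 2 * (1 / N) ≤ 1 / (4 * r) :=
    (le_div_iff₀' (by positivity)).2 hrN
  have ha1 : (1 : ℝ) ≤ a := by exact_mod_cast ha
  have hn : (0 : ℝ) ≤ 1 / N := by positivity
  calc schur ε N (2 * r - 1 / N) a a 0 = 2 * r - 1 / N + ε * (2 * a) := by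
        simp only [schur, diagElem, Nat.cast_zero]
        ring
    _ ≤ 2 * a * (1 + ε - r + 5 / 2 * (1 / N)) := by
        nlinarith [mul_nonneg (sub_nonneg.2 ha1) hn]
    _ ≤ 2 * a * (1 / (4 * r)) := by gcongr
    _ = a / (2 * r) := by field_simp; ring

theorem schur_condensate_le (hN : 0 < N) (hr0 : 0 < r) (hr : r ≤ 1 / 2)
    (hrN : 4 * r * (1 + ε - r + 5 / 2 * (1 / N)) ≤ 1) {p : ℝ}
    (hgap : HasSchurGap ε N (2 * r - 1 / N) p) :
    ∀ {c a : ℕ}, a + a + c = N → Even c → schur ε N (2 * r - 1 / N) a a c ≤ a / (2 * r) := by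
  intro c
  induction c using Nat.twoStepInduction with
  | zero =>
    intro a ha _
    exact schur_condensate_zero_le (by omega) hr0 hr hrN
  | one => exact fun _ h => absurd h (by decide)
  | more c ih _ =>
    intro a ha hc
    have hnext := ih (a := a + 1) (by omega) (by rwa [Nat.even_add, iff_true_right even_two] at hc)
    have hpos : 0 < schur ε N (2 * r - 1 / N) (a + 1) (a + 1) c :=
      hgap.schur_pos (by omega) (by omega)
    have hc2 : ((c : ℝ) + 2) / N = 1 - 2 * a * (1 / N) := by
      have hcast : (a : ℝ) + a + (c + 2) = N := by exact_mod_cast ha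
      field_simp
      linarith
    have hc1 : ((c : ℝ) + 1) / N = 1 - 2 * a * (1 / N) - 1 / N := by rw [← hc2]; ring
    calc schur ε N (2 * r - 1 / N) a a (c + 2)
        ≤ diagElem ε N (2 * r - 1 / N) a a (c + 2) -
            ((c + 2) * (c + 1) * (a + 1) * (a + 1)) / N ^ 2 / ((a + 1 : ℕ) / (2 * r)) := by
          rw [schur]
          gcongr
      _ = 2 * r - 1 / N + (ε + (c + 2) / N) * (2 * a) -
            (c + 2) / N * ((c + 1) / N) * (r * (2 * a + 2)) := by
          simp only [diagElem]
          push_cast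
          field_simp
          ring
      _ ≤ 2 * a * (1 / (4 * r)) := by
          rw [hc2, hc1]
          exact condensate_step (by positivity) (by positivity) hr0 hr hrN
      _ = a / (2 * r) := by field_simp; ring

/-- Distance of the zero of `f` from `E^Bog` admitted by the finite-size effects, in units of
`φ`. -/
noncomputable def finiteSizeShift (ε : ℝ) (N : ℕ) : ℝ := (1 + 5 / (2 * dispersion ε)) / N

theorem threshold_pos (hε : 0 < ε) (hε' : ε ≤ 1 / 100) : 0 < threshold ε := by
  have hs' := dispersion_le_sqrt hε.le hε'
  have he := sqrt_le_tenth hε'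
  have hs := dispersion_pos hε
  rw [threshold]
  nlinarith

theorem threshold_le_sub_finiteSizeShift
    (hshift : finiteSizeShift ε N ≤ √ε * dispersion ε) :
    threshold ε ≤ 1 + ε - dispersion ε - finiteSizeShift ε N := by
  rw [threshold]
  linarith

theorem schur_condensate_nonpos (hε : 0 < ε) (hε' : ε ≤ 1 / 100) (hN : 0 < N) (hE : Even N)
    (hshift : finiteSizeShift ε N ≤ √ε * dispersion ε) :
    schur ε N (1 + ε - dispersion ε - finiteSizeShift ε N) 0 0 N ≤ 0 := by
  have hgap := (hasSchurGap_threshold hε hε' hN).mono (threshold_le_sub_finiteSizeShift hshift)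
  have hpos := (threshold_pos hε hε').trans_le (threshold_le_sub_finiteSizeShift hshift)
  have hs := dispersion_pos hε
  have hs2 := dispersion_sq hε.le
  have hsε := le_dispersion hε.le
  -- The correction `ρ` to Bogoliubov's slope absorbs the finite-size term of `condensate_step`.
  obtain ⟨ρ, hρ⟩ : ∃ ρ, ρ = 5 / (4 * N * dispersion ε) := ⟨_, rfl⟩
  have hρ0 : 0 < ρ := by rw [hρ]; positivity
  have hρs : 5 / 2 * (1 / (N : ℝ)) = 2 * (ρ * dispersion ε) := by rw [hρ]; field_simp; norm_num
  have hx : 1 + ε - dispersion ε - finiteSizeShift ε N =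
      2 * ((1 + ε - dispersion ε) / 2 - ρ) - 1 / N := by
    rw [hρ, finiteSizeShift]
    field_simp
    ring
  have hr0 : 0 < (1 + ε - dispersion ε) / 2 - ρ := by
    rw [hx] at hpos
    have : (0 : ℝ) < 1 / N := by positivity
    linarith
  have hrN : 4 * ((1 + ε - dispersion ε) / 2 - ρ) *
      (1 + ε - ((1 + ε - dispersion ε) / 2 - ρ) + 5 / 2 * (1 / N)) ≤ 1 := by
    have hfirst : 0 ≤ ρ * dispersion ε * (dispersion ε - ε) :=
      mul_nonneg (by positivity) (sub_nonneg.2 hsε)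
    have hsecond : 0 ≤ ρ * (ρ + 2 * (ρ * dispersion ε)) := by positivity
    rw [hρs]
    linear_combination 4 * hfirst + 4 * hsecond - hs2
  rw [hx] at hgap ⊢
  simpa using schur_condensate_le hN hr0 (by linarith) hrN hgap (a := 0) (by omega) hE

theorem exists_schur_eq_zero (hε : 0 < ε) (hε' : ε ≤ 1 / 100) (hN : 0 < N) (hE : Even N)
    (hshift : finiteSizeShift ε N ≤ √ε * dispersion ε) :
    ∃ x ≥ 1 + ε - dispersion ε - finiteSizeShift ε N, schur ε N x 0 0 N = 0 := by
  set x₀ := 1 + ε - dispersion ε - finiteSizeShift ε N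
  have hgap := (hasSchurGap_threshold hε hε' hN).mono (threshold_le_sub_finiteSizeShift hshift)
  have hnonpos : schur ε N x₀ 0 0 N ≤ 0 := schur_condensate_nonpos hε hε' hN hE hshift
  have hle : x₀ ≤ x₀ - schur ε N x₀ 0 0 N := by linarith
  have hnonneg : 0 ≤ schur ε N (x₀ - schur ε N x₀ 0 0 N) 0 0 N := by
    linarith [hgap.schur_add_sub_le hle (a := 0) (b := 0) (c := N) (by omega)]
  obtain ⟨x, hx, hzero⟩ := intermediate_value_Icc hle
    ((hgap.continuousOn_schur (a := 0) (b := 0) (c := N) (by omega)).mono Set.Icc_subset_Ici_self)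
    ⟨hnonpos, hnonneg⟩
  exact ⟨x, hx.1, hzero⟩

theorem schur_injOn (hε : 0 < ε) (hε' : ε ≤ 1 / 100) (hN : 0 < N) :
    Set.InjOn (fun x => schur ε N x 0 0 N) (Set.Ici (threshold ε)) :=
  ((hasSchurGap_threshold hε hε' hN).strictMonoOn_schur (by omega)).injOn

theorem finiteSizeShift_lt (hε : 0 < ε) (hε' : ε ≤ 1 / 100)
    (hNε : 1 / (N : ℝ) ≤ 1 / 10 * (ε * √ε)) :
    finiteSizeShift ε N < 9 / 10 * (√ε * dispersion ε) := by
  have hs := sqrt_le_dispersion hε.le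
  have he := sqrt_le_tenth hε'
  have he0 := Real.sqrt_pos.2 hε
  have hsq : √ε * √ε = ε := Real.mul_self_sqrt hε.le
  calc finiteSizeShift ε N = (1 + 5 / (2 * dispersion ε)) * (1 / N) := by
        rw [finiteSizeShift, div_eq_mul_one_div]
    _ ≤ (1 + 5 / (2 * (1.4 * √ε))) * (1 / 10 * (ε * √ε)) := by gcongr
    _ = √ε * (1 / 10 * ε + 5 / 28 * √ε) := by
        field_simp
        linear_combination -140 * hsq
    _ < √ε * (9 / 10 * dispersion ε) := by gcongr; nlinarith
    _ = 9 / 10 * (√ε * dispersion ε) := by ring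

end CondensateChain

section FeshbachFlow

variable {d N : ℕ} {js : Mode d} {φ L z p : ℝ}

/-- Diagonal matrix element of `H - z` on the product state with occupation numbers `n`. -/
noncomputable def diagElemOcc (L φ : ℝ) (js : Mode d) (z : ℝ) (n : Occ d N) : ℝ :=
  φ * diagElem (eps L φ js) N ((kinOther L js n - z) / φ) (n.1 js) (n.1 (-js)) (n.1 0)

/-- Schur complement of `H - z` onto the product state with occupation numbers `n`, along the chain
of its promotions. -/
noncomputable def schurOcc (L φ : ℝ) (js : Mode d) (z : ℝ) (n : Occ d N) : ℝ :=
  φ * schur (eps L φ js) N ((kinOther L js n - z) / φ) (n.1 js) (n.1 (-js)) (n.1 0)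

theorem diagElemOcc_sub_schurOcc (hφ : φ ≠ 0) (hjs : js ≠ 0) (n : Occ d N) :
    diagElemOcc L φ js z n - schurOcc L φ js z n =
      (promote js n).elim 0 fun n' => wCoeff φ js n ^ 2 * (schurOcc L φ js z n')⁻¹ := by
  cases h : promote js n with
  | none =>
    have hn := lt_two_of_promote_eq_none h
    simp only [diagElemOcc, schurOcc, Option.elim_none]
    interval_cases n.1 0 <;> simp only [schur, sub_self]
  | some n' =>
    have hc := promote_apply_zero hjs h
    rw [Option.elim_some, wCoeff_sq φ js (by omega), diagElemOcc, schurOcc, schurOcc,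
      kinOther_promote h, promote_apply_pos hjs h, promote_apply_neg hjs h, hc, schur]
    push_cast
    field_simp
    ring

theorem isDiagonal_W_mul_mul_Wstar (hφ : φ ≠ 0) (hjs : js ≠ 0) {i : ℕ}
    {X : FockN d N →L[ℂ] FockN d N}
    (hX : IsDiagonal X ((sector js i).indicator (schurOcc L φ js z)⁻¹)) :
    IsDiagonal (W d N φ js * X * Wstar d N φ js)
      ((sector js (i + 2)).indicator (diagElemOcc L φ js z - schurOcc L φ js z)) := by
  refine ((isWeightedShift_W hjs φ).isDiagonal_conj hX).congr fun n => ?_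
  have hrec := diagElemOcc_sub_schurOcc (L := L) (z := z) hφ hjs n
  cases h : promote js n with
  | none => by_cases hn : n ∈ sector js (i + 2) <;> simp_all
  | some n' =>
    have hmem := promote_mem_sector_iff hjs h (i := i)
    by_cases hn : n ∈ sector js (i + 2) <;> simp_all

theorem notMem_sector_of_mem_sector_add_two {i : ℕ} {n : Occ d N} (hn : n ∈ sector js (i + 2)) :
    n ∉ sector js i := by
  rw [mem_sector] at hn ⊢
  omega

theorem eq_zero_of_Q_apply_eq {i : ℕ} {ψ : FockN d N} (hψ : Q d N js i ψ = ψ) {n : Occ d N}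
    (hn : n ∉ sector js i) : ψ n = 0 := by
  rw [← hψ, isDiagonal_Q, Set.indicator_of_notMem hn, Complex.ofReal_zero, zero_mul]

theorem W_apply_eq_zero_of_Q_apply_eq (hjs : js ≠ 0) {i : ℕ} {ψ : FockN d N}
    (hψ : Q d N js i ψ = ψ) {n : Occ d N} (hn : n ∈ sector js i) : W d N φ js ψ n = 0 := by
  rw [isWeightedShift_W hjs]
  cases h : promote js n with
  | none => rfl
  | some n' =>
    have hn' : n' ∉ sector js i := fun hn' =>
      notMem_sector_of_mem_sector_add_two ((promote_mem_sector_iff hjs h).1 hn') hn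
    rw [Option.elim_some, eq_zero_of_Q_apply_eq hψ hn', mul_zero]

theorem Wstar_apply_eq_zero_of_Q_apply_eq (hjs : js ≠ 0) {i : ℕ} {ψ : FockN d N}
    (hψ : Q d N js i ψ = ψ) {n : Occ d N} (hn : n ∈ sector js i) : Wstar d N φ js ψ n = 0 := by
  rw [Wstar, (isWeightedShift_W hjs φ).adjoint]
  cases h : (promote js).symm n with
  | none => rfl
  | some n' =>
    have hn' : n' ∉ sector js i := notMem_sector_of_mem_sector_add_two <|
      (promote_mem_sector_iff hjs ((PEquiv.mem_iff_mem _).1 h)).1 hn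
    rw [Option.elim_some, eq_zero_of_Q_apply_eq hψ hn', mul_zero]

theorem hHat0_apply (ψ : FockN d N) (n : Occ d N) :
    hHat0 d N L φ js ψ n =
      (((kSq L js + φ / N * n.1 0) * ((n.1 js : ℝ) + n.1 (-js)) : ℝ) : ℂ) * ψ n := by
  have hcoef : IsDiagonal (((kSq L js : ℝ) : ℂ) • 1 + ((φ / N : ℝ) : ℂ) • num d N 0) _ :=
    (IsDiagonal.one.smul (kSq L js)).add ((isDiagonal_num 0).smul (φ / N))
  rw [hHat0, (hcoef.mul (isDiagonal_num js)).add (hcoef.mul (isDiagonal_num (-js)))]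
  simp only [Pi.add_apply, Pi.mul_apply, Pi.smul_apply, Pi.one_apply, smul_eq_mul, mul_one]
  push_cast
  ring

theorem hBog_sub_smul_apply (hφ : φ ≠ 0) (ψ : (hBog d N L φ js).domain) (n : Occ d N) :
    (hBog d N L φ js ψ - (z : ℂ) • (ψ : FockN d N)) n =
      diagElemOcc L φ js z n * ψ.1 n + W d N φ js ψ n + Wstar d N φ js ψ n := by
  change (kinOther L js n : ℂ) * ψ.1 n + (hHat0 d N L φ js ψ.1 n + W d N φ js ψ.1 n +
    Wstar d N φ js ψ.1 n) - (z : ℂ) * ψ.1 n = _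
  have hdiag : diagElemOcc L φ js z n = kinOther L js n - z +
      (kSq L js + φ / N * n.1 0) * ((n.1 js : ℝ) + n.1 (-js)) := by
    rw [diagElemOcc, diagElem, eps]
    field_simp
  rw [hHat0_apply, hdiag]
  push_cast
  ring

theorem mem_domain_hBog_of_isDiagonal {R : FockN d N →L[ℂ] FockN d N} {v : Occ d N → ℝ}
    (hR : IsDiagonal R v) {M : ℝ} (hM : 0 ≤ M) (hv : ∀ n, |kinOther L js n * v n| ≤ M)
    (ψ : FockN d N) : R ψ ∈ (hBog d N L φ js).domain := by
  obtain ⟨Y, hY⟩ := IsDiagonal.exists_of_bounded hM hv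
  have hYR : (fun n => (kinOther L js n : ℂ) * R ψ n) = ⇑(Y ψ) := by
    ext n
    rw [hY, hR, Complex.ofReal_mul, mul_assoc]
  change Memℓp (fun n => (kinOther L js n : ℂ) * R ψ n) 2
  exact hYR ▸ lp.memℓp (Y ψ)

theorem eps_nonneg (hφ : 0 < φ) : 0 ≤ eps L φ js := div_nonneg (kSq_nonneg js) hφ.le

theorem neg_div_le_kinOther_sub_div (hφ : 0 < φ) (n : Occ d N) :
    -z / φ ≤ (kinOther L js n - z) / φ := by
  gcongr
  linarith [kinOther_nonneg (L := L) (js := js) n]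

theorem one_le_of_mem_sector {i : ℕ} (hi : i + 2 ≤ N) {n : Occ d N} (hn : n ∈ sector js i) :
    1 ≤ n.1 js + n.1 (-js) := by
  rw [mem_sector] at hn
  omega

theorem kinOther_add_le_schurOcc (hφ : 0 < φ) (hjs : js ≠ 0)
    (hgap : HasSchurGap (eps L φ js) N (-z / φ) p) {i : ℕ} (hi : i + 2 ≤ N) {n : Occ d N}
    (hn : n ∈ sector js i) : kinOther L js n + φ * p ≤ schurOcc L φ js z n := by
  have hx := neg_div_le_kinOther_sub_div (L := L) (js := js) (z := z) hφ n
  calc kinOther L js n + φ * p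
      = φ * (p + ((kinOther L js n - z) / φ - -z / φ)) := by field_simp; ring
    _ ≤ schurOcc L φ js z n := by
        rw [schurOcc]
        gcongr
        linarith [hgap.schur_add_sub_le hx (occ_add_le hjs n),
          hgap.le_schur _ _ _ (one_le_of_mem_sector hi hn) (occ_add_le hjs n)]

theorem schurOcc_le_diagElemOcc (hφ : 0 < φ) (hjs : js ≠ 0)
    (hgap : HasSchurGap (eps L φ js) N (-z / φ) p) (n : Occ d N) :
    schurOcc L φ js z n ≤ diagElemOcc L φ js z n := by
  rw [schurOcc, diagElemOcc]
  gcongr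
  exact (hgap.mono (neg_div_le_kinOther_sub_div hφ n)).schur_le_diagElem (occ_add_le hjs n)

theorem diagElemOcc_le (hφ : 0 < φ) (hjs : js ≠ 0) (n : Occ d N) :
    diagElemOcc L φ js z n ≤ kinOther L js n + (|z| + φ * ((eps L φ js + 1) * N)) := by
  have hab : (n.1 js : ℝ) + n.1 (-js) ≤ N := by
    exact_mod_cast le_self_add.trans (occ_add_le hjs n)
  have hc : (n.1 0 : ℝ) / N ≤ 1 :=
    div_le_one_of_le₀ (by exact_mod_cast le_add_self.trans (occ_add_le hjs n)) (by positivity)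
  have hε := eps_nonneg (L := L) (js := js) hφ
  calc diagElemOcc L φ js z n
      = kinOther L js n - z + φ * ((eps L φ js + n.1 0 / N) * (n.1 js + n.1 (-js))) := by
        rw [diagElemOcc, diagElem]
        field_simp
    _ ≤ kinOther L js n + |z| + φ * ((eps L φ js + 1) * N) := by
        gcongr
        linarith [neg_abs_le z]
    _ = _ := add_assoc _ _ _

theorem kinOther_add_mul_abs_inv_le_one (hφ : 0 < φ) (hjs : js ≠ 0)
    (hgap : HasSchurGap (eps L φ js) N (-z / φ) p) {i : ℕ} (hi : i + 2 ≤ N) (n : Occ d N) :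
    (kinOther L js n + φ * p) * |(sector js i).indicator (diagElemOcc L φ js z)⁻¹ n| ≤ 1 := by
  by_cases hn : n ∈ sector js i
  · have hp := mul_pos hφ hgap.pos
    have hle : kinOther L js n + φ * p ≤ diagElemOcc L φ js z n :=
      (kinOther_add_le_schurOcc hφ hjs hgap hi hn).trans (schurOcc_le_diagElemOcc hφ hjs hgap n)
    have hpos : 0 < diagElemOcc L φ js z n :=
      (add_pos_of_nonneg_of_pos (kinOther_nonneg n) hp).trans_le hle
    rwa [Set.indicator_of_mem hn, Pi.inv_apply, abs_of_pos (inv_pos.2 hpos), ← div_eq_mul_inv,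
      div_le_one hpos]
  · rw [Set.indicator_of_notMem hn, abs_zero, mul_zero]
    exact zero_le_one

theorem exists_isReducedResolvent_isDiagonal (hφ : 0 < φ) (hjs : js ≠ 0)
    (hgap : HasSchurGap (eps L φ js) N (-z / φ) p) {i : ℕ} (hi : i + 2 ≤ N) :
    ∃ R : FockN d N →L[ℂ] FockN d N,
      IsReducedResolvent (hBog d N L φ js) (Q d N js i) (z : ℂ) R ∧
      IsDiagonal R ((sector js i).indicator (diagElemOcc L φ js z)⁻¹) := by
  have hp := mul_pos hφ hgap.pos
  have hbound := kinOther_add_mul_abs_inv_le_one (d := d) hφ hjs hgap hi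
  have hkin (n : Occ d N) : 0 ≤ kinOther L js n := kinOther_nonneg n
  obtain ⟨R, hR⟩ : ∃ R : FockN d N →L[ℂ] FockN d N,
      IsDiagonal R ((sector js i).indicator (diagElemOcc L φ js z)⁻¹) :=
    IsDiagonal.exists_of_bounded (M := 1 / (φ * p)) (by positivity) fun n => by
      rw [le_div_iff₀' hp]
      exact (mul_le_mul_of_nonneg_right (le_add_of_nonneg_left (hkin n)) (abs_nonneg _)).trans
        (hbound n)
  have hdom : ∀ ψ, R ψ ∈ (hBog d N L φ js).domain :=
    mem_domain_hBog_of_isDiagonal hR zero_le_one fun n => by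
      rw [abs_mul, abs_of_nonneg (hkin n)]
      exact (mul_le_mul_of_nonneg_right (le_add_of_nonneg_right hp.le) (abs_nonneg _)).trans
        (hbound n)
  have hne : ∀ n ∈ sector js i, diagElemOcc L φ js z n ≠ 0 := fun n hn =>
    ((add_pos_of_nonneg_of_pos (hkin n) hp).trans_le <|
      (kinOther_add_le_schurOcc hφ hjs hgap hi hn).trans
        (schurOcc_le_diagElemOcc hφ hjs hgap n)).ne'
  refine ⟨R, isReducedResolvent_of_isDiagonal (isDiagonal_Q i) hR hne hdom fun ψ hψ n hn => ?_, hR⟩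
  rw [hBog_sub_smul_apply hφ.ne', W_apply_eq_zero_of_Q_apply_eq hjs hψ hn,
    Wstar_apply_eq_zero_of_Q_apply_eq hjs hψ hn, add_zero, add_zero]

theorem isDiagonal_resBog (hφ : 0 < φ) (hjs : js ≠ 0)
    (hgap : HasSchurGap (eps L φ js) N (-z / φ) p) {i : ℕ} (hi : i + 2 ≤ N) :
    IsDiagonal (resBog d N L φ js z i)
      ((sector js i).indicator (diagElemOcc L φ js z)⁻¹) := by
  obtain ⟨R, hR, hdiag⟩ := exists_isReducedResolvent_isDiagonal (d := d) hφ hjs hgap hi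
  rwa [resBog, hR.reducedResolvent_eq]

theorem neumann_resBog (hφ : 0 < φ) (hjs : js ≠ 0)
    (hgap : HasSchurGap (eps L φ js) N (-z / φ) p) {i : ℕ} (hi : i + 2 ≤ N)
    {G : FockN d N →L[ℂ] FockN d N} (hG : IsDiagonal G
      ((sector js i).indicator (diagElemOcc L φ js z - schurOcc L φ js z))) :
    (Summable fun l : ℕ => (G * resBog d N L φ js z i) ^ l) ∧
      IsDiagonal (resBog d N L φ js z i * ∑' l : ℕ, (G * resBog d N L φ js z i) ^ l)
        ((sector js i).indicator (schurOcc L φ js z)⁻¹) := by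
  have hε := eps_nonneg (L := L) (js := js) hφ
  have hp := mul_pos hφ hgap.pos
  have hlow : ∀ n ∈ sector js i, kinOther L js n + φ * p ≤ schurOcc L φ js z n :=
    fun n hn => kinOther_add_le_schurOcc hφ hjs hgap hi hn
  refine (isDiagonal_resBog hφ hjs hgap hi).neumann hG hp
    (D := |z| + φ * ((eps L φ js + 1) * N)) (by positivity)
    (fun n hn => (le_add_of_nonneg_left (kinOther_nonneg n)).trans (hlow n hn))
    (fun n _ => schurOcc_le_diagElemOcc hφ hjs hgap n) fun n hn => ?_
  linarith [hlow n hn, diagElemOcc_le (L := L) (z := z) hφ hjs n]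

theorem isDiagonal_gammaBog (hφ : 0 < φ) (hjs : js ≠ 0)
    (hgap : HasSchurGap (eps L φ js) N (-z / φ) p) {k : ℕ} (hk : 2 * k + 2 ≤ N) :
    IsDiagonal (gammaBog d N L φ js z k)
      ((sector js (2 * k)).indicator (diagElemOcc L φ js z - schurOcc L φ js z)) := by
  induction k with
  | zero =>
    have hzero (n : Occ d N) (hn : n ∈ sector js 0) :
        diagElemOcc L φ js z n - schurOcc L φ js z n = 0 := by
      have hocc := occ_add_le hjs n
      rw [diagElemOcc_sub_schurOcc hφ.ne' hjs]
      cases h : promote js n with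
      | none => rfl
      | some n' =>
        have hc := promote_apply_zero hjs h
        rw [mem_sector] at hn
        omega
    intro ψ n
    by_cases hn : n ∈ sector js 0 <;> simp [gammaBog, hn, hzero]
  | succ k ih =>
    have hX := (neumann_resBog hφ hjs hgap (by omega) (ih (by omega))).2
    have hQ (i : ℕ) := isDiagonal_Q (d := d) (N := N) (js := js) i
    have hQXQ : IsDiagonal _ ((sector js (2 * k)).indicator (schurOcc L φ js z)⁻¹) :=
      (((hQ (2 * k)).mul hX).mul (hQ (2 * k))).congr fun n => by
        by_cases hn : n ∈ sector js (2 * k) <;> simp [hn]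
    have hΓ := ((hQ (2 * k + 2)).mul (isDiagonal_W_mul_mul_Wstar hφ.ne' hjs hQXQ)).mul
      (hQ (2 * k + 2))
    simp only [mul_assoc] at hΓ
    simp only [gammaBog, mul_assoc]
    exact hΓ.congr fun n => by
      by_cases hn : n ∈ sector js (2 * (k + 1)) <;> simp_all [mul_add]

theorem fWellDefined_of_hasSchurGap (hφ : 0 < φ) (hjs : js ≠ 0)
    (hgap : HasSchurGap (eps L φ js) N (-z / φ) p) : FWellDefined d N L φ js z := fun _ hk =>
  ⟨(exists_isReducedResolvent_isDiagonal hφ hjs hgap hk).imp fun _ => And.left,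
    (neumann_resBog hφ hjs hgap hk (isDiagonal_gammaBog hφ hjs hgap hk)).1⟩

/-- The condensate, with all particles in the mode `0`. -/
noncomputable def condensate (d N : ℕ) : Occ d N := ⟨Finsupp.single 0 N, by simp⟩

theorem kinOther_condensate : kinOther L js (condensate d N) = 0 := by
  rw [kinOther, condensate, Finsupp.sum_single_index (by simp)]
  simp [kSq_zero]

theorem diagElemOcc_condensate (hφ : φ ≠ 0) (hjs : js ≠ 0) :
    diagElemOcc L φ js z (condensate d N) = -z := by
  rw [diagElemOcc, kinOther_condensate]
  simp [diagElem, condensate, hjs, mul_div_cancel₀ _ hφ]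

theorem schurOcc_condensate (hjs : js ≠ 0) :
    schurOcc L φ js z (condensate d N) = φ * schur (eps L φ js) N (-z / φ) 0 0 N := by
  rw [schurOcc, kinOther_condensate]
  simp [condensate, hjs]

theorem f_eq_schur (hφ : 0 < φ) (hjs : js ≠ 0) (hN : 0 < N) (hE : Even N)
    (hgap : HasSchurGap (eps L φ js) N (-z / φ) p) :
    f d N L φ js z = (φ * schur (eps L φ js) N (-z / φ) 0 0 N : ℝ) := by
  obtain ⟨k, rfl⟩ : ∃ k, N = 2 * k + 2 := ⟨N / 2 - 1, by obtain ⟨m, rfl⟩ := hE; omega⟩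
  have hX := (neumann_resBog hφ hjs hgap le_rfl (isDiagonal_gammaBog hφ hjs hgap le_rfl)).2
  have hWXW := isDiagonal_W_mul_mul_Wstar hφ.ne' hjs hX
  have hmem : condensate d (2 * k + 2) ∈ sector js (2 * k + 2) := by
    simp [mem_sector, condensate, hjs]
  have heta : eta d (2 * k + 2) = basisVec (condensate d (2 * k + 2)) := by
    unfold eta basisVec condensate
    congr!
  have hk : (2 * k + 2) / 2 - 1 = k := by omega
  have hk' : 2 * k + 2 - 2 = 2 * k := by omega
  rw [f, hk, hk', heta, mul_assoc (W _ _ _ _), hWXW.inner_basisVec, Set.indicator_of_mem hmem,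
    Pi.sub_apply, diagElemOcc_condensate hφ.ne' hjs, schurOcc_condensate hjs]
  push_cast
  ring

end FeshbachFlow

section ZeroOfFeshbachFunction

variable {d N : ℕ} {js : Mode d} {L φ z : ℝ}

theorem eps_pos (hL : 0 < L) (hφ : 0 < φ) (hjs : js ≠ 0) : 0 < eps L φ js :=
  div_pos (kSq_pos hL hjs) hφ

theorem eBog_eq (hφ : 0 < φ) :
    eBog L φ js = -(φ * (1 + eps L φ js - dispersion (eps L φ js))) := by
  have hk : kSq L js = φ * eps L φ js := by rw [eps]; field_simp
  have hsqrt : √((φ * eps L φ js) ^ 2 + 2 * φ * (φ * eps L φ js)) =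
      φ * dispersion (eps L φ js) := by
    rw [dispersion, ← Real.sqrt_sq hφ.le, ← Real.sqrt_mul (sq_nonneg _), Real.sqrt_sq hφ.le]
    congr 1
    ring
  rw [eBog, hk, hsqrt]
  ring

theorem eBog_add_eq (hφ : 0 < φ) :
    eBog L φ js + √(eps L φ js) * φ * dispersion (eps L φ js) =
      -(φ * threshold (eps L φ js)) := by
  rw [eBog_eq hφ, threshold]
  ring

theorem threshold_le_neg_div (hφ : 0 < φ) (hz : z ≤ -(φ * threshold (eps L φ js))) :
    threshold (eps L φ js) ≤ -z / φ := by
  rw [le_div_iff₀' hφ]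
  linarith

theorem fWellDefined_of_le_threshold (hL : 0 < L) (hφ : 0 < φ) (hjs : js ≠ 0) (hN : 0 < N)
    (hε : eps L φ js ≤ 1 / 100) (hz : z ≤ -(φ * threshold (eps L φ js))) :
    FWellDefined d N L φ js z :=
  fWellDefined_of_hasSchurGap hφ hjs <|
    (hasSchurGap_threshold (eps_pos hL hφ hjs) hε hN).mono (threshold_le_neg_div hφ hz)

theorem f_eq_schur_of_le_threshold (hL : 0 < L) (hφ : 0 < φ) (hjs : js ≠ 0) (hN : 0 < N)
    (hE : Even N) (hε : eps L φ js ≤ 1 / 100) (hz : z ≤ -(φ * threshold (eps L φ js))) :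
    f d N L φ js z = (φ * schur (eps L φ js) N (-z / φ) 0 0 N : ℝ) :=
  f_eq_schur hφ hjs hN hE <|
    (hasSchurGap_threshold (eps_pos hL hφ hjs) hε hN).mono (threshold_le_neg_div hφ hz)

theorem exists_f_eq_zero (hL : 0 < L) (hφ : 0 < φ) (hjs : js ≠ 0) (hN : 0 < N) (hE : Even N)
    (hε : eps L φ js ≤ 1 / 100)
    (hshift : finiteSizeShift (eps L φ js) N ≤ √(eps L φ js) * dispersion (eps L φ js)) :
    ∃ z ≤ eBog L φ js + φ * finiteSizeShift (eps L φ js) N, f d N L φ js z = 0 := by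
  obtain ⟨x, hx, hzero⟩ := exists_schur_eq_zero (eps_pos hL hφ hjs) hε hN hE hshift
  refine ⟨-(φ * x), ?_, ?_⟩
  · rw [eBog_eq hφ]
    linarith [mul_le_mul_of_nonneg_left hx hφ.le]
  · have hxt : threshold (eps L φ js) ≤ x := (threshold_le_sub_finiteSizeShift hshift).trans hx
    rw [f_eq_schur_of_le_threshold hL hφ hjs hN hE hε (by gcongr), neg_neg,
      mul_div_cancel_left₀ _ hφ.ne', hzero, mul_zero, Complex.ofReal_zero]

theorem f_injOn (hL : 0 < L) (hφ : 0 < φ) (hjs : js ≠ 0) (hN : 0 < N) (hE : Even N)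
    (hε : eps L φ js ≤ 1 / 100) :
    Set.InjOn (f d N L φ js) (Set.Iic (-(φ * threshold (eps L φ js)))) := fun z hz z' hz' h => by
  rw [f_eq_schur_of_le_threshold hL hφ hjs hN hE hε hz,
    f_eq_schur_of_le_threshold hL hφ hjs hN hE hε hz', Complex.ofReal_inj,
    mul_right_inj' hφ.ne'] at h
  have heq := schur_injOn (eps_pos hL hφ hjs) hε hN (threshold_le_neg_div hφ hz)
    (threshold_le_neg_div hφ hz') h
  rwa [div_left_inj' hφ.ne', neg_inj] at heq

end ZeroOfFeshbachFunction

end ThreeModeBog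

open ThreeModeBog in
theorem mainTheorem2_general {d N : ℕ} {L φ : ℝ} {js : Mode d} (hL : 0 < L) (hφ : 0 < φ)
    (hjs : js ≠ 0) (hN : 0 < N) (hE : Even N) {ε : ℝ} (hε : ε = eps L φ js) (hε₀ : ε ≤ 1 / 100)
    (hNε : 1 / (N : ℝ) ≤ 1 / 10 * (ε * √ε)) {zmax : ℝ}
    (hzmax : zmax = eBog L φ js + √ε * φ * √(ε ^ 2 + 2 * ε)) :
    zmax < 0 ∧ (∀ z ≤ zmax, FWellDefined d N L φ js z) ∧
      ∃ zs ≤ zmax, f d N L φ js zs = 0 ∧ (∀ z ≤ zmax, f d N L φ js z = 0 → z = zs) ∧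
        zs < eBog L φ js + (2 * √2 + 3) / 6 * √ε * φ * √(ε ^ 2 + 2 * ε) := by
  subst hε
  rw [← dispersion] at hzmax ⊢
  have hεpos := eps_pos hL hφ hjs
  have hmax : zmax = -(φ * threshold (eps L φ js)) := hzmax.trans (eBog_add_eq hφ)
  have hshift := finiteSizeShift_lt hεpos hε₀ hNε
  have hs := dispersion_pos hεpos
  have hconst : 9 / 10 ≤ (2 * √2 + 3) / 6 := by
    linarith [Real.le_sqrt_of_sq_le (by norm_num : (1.2 : ℝ) ^ 2 ≤ 2)]
  have hwidth : 0 < √(eps L φ js) * dispersion (eps L φ js) := by positivity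
  obtain ⟨zs, hle, hzero⟩ := exists_f_eq_zero hL hφ hjs hN hE hε₀ (by linarith)
  have hzs : zs < eBog L φ js + 9 / 10 * (√(eps L φ js) * φ * dispersion (eps L φ js)) := by
    linarith [mul_lt_mul_of_pos_left hshift hφ]
  have hzsmax : zs ≤ zmax := by linarith [mul_pos hφ hwidth]
  refine ⟨?_, fun z hz => fWellDefined_of_le_threshold hL hφ hjs hN hε₀ (hz.trans_eq hmax),
    zs, hzsmax, hzero, fun z hz h => f_injOn hL hφ hjs hN hE hε₀ (hz.trans_eq hmax)
      (hzsmax.trans_eq hmax) (h.trans hzero.symm), hzs.trans_le ?_⟩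
  · rw [hmax, neg_lt_zero]
    exact mul_pos hφ (threshold_pos hεpos hε₀)
  · calc eBog L φ js + 9 / 10 * (√(eps L φ js) * φ * dispersion (eps L φ js))
        ≤ eBog L φ js + (2 * √2 + 3) / 6 * (√(eps L φ js) * φ * dispersion (eps L φ js)) := by
          gcongr
      _ = _ := by ring

theorem mainTheorem2 (γ : ℝ) (hγ0 : 0 < γ) (hγ1 : γ < 1) :
    ∃ kγ : ℝ, 0 < kγ ∧ ∃ ε₀ : ℝ, 0 < ε₀ ∧
      ∀ (d N : ℕ) (L φ : ℝ) (js : ThreeModeBog.Mode d), 0 < L → 0 < φ → js ≠ 0 → 0 < N → Even N →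
      ∀ ε : ℝ, ε = ThreeModeBog.eps L φ js → ε ≤ ε₀ →
        ε ^ 2 + ε / (N : ℝ) ^ γ + 1 / (N : ℝ) ≤ kγ * (ε * Real.sqrt ε) →
        1 / (N : ℝ) ^ (1 - γ) ≤ kγ * ε →
      ∀ zmax : ℝ, zmax = ThreeModeBog.eBog L φ js +
          Real.sqrt ε * φ * Real.sqrt (ε ^ 2 + 2 * ε) →
        zmax < 0 ∧
        (∀ z ≤ zmax, ThreeModeBog.FWellDefined d N L φ js z) ∧
        ∃ zs ≤ zmax, ThreeModeBog.f d N L φ js zs = 0 ∧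
          (∀ z ≤ zmax, ThreeModeBog.f d N L φ js z = 0 → z = zs) ∧
          zs < ThreeModeBog.eBog L φ js +
            (2 * Real.sqrt 2 + 3) / 6 * Real.sqrt ε * φ * Real.sqrt (ε ^ 2 + 2 * ε) := by
  refine ⟨1 / 10, by norm_num, 1 / 100, by norm_num,
    fun d N L φ js hL hφ hjs hN hE ε hε hε₀ hNε _ zmax hzmax => ?_⟩
  have hpos : 0 ≤ ε ^ 2 + ε / (N : ℝ) ^ γ := by
    have hε0 : 0 ≤ ε := hε ▸ ThreeModeBog.eps_nonneg hφ
    positivity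
  exact mainTheorem2_general hL hφ hjs hN hE hε hε₀ (by linarith) hzmax
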